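/- Let $k$ be a field, let $(T,E)$ be the $3$-regular tree with distance function $d$, and let $f_0=0$, $f_1=1$, $f_{i+1}=f_i+f_{i-1}$ be the Fibonacci numbers. For a vertex $x$ let $s(x)\in\mathbb Z^{(T)}$ be the corresponding basis vector, and for a vertex $y$ let $\sigma^y$ be the reflection with $(\sigma^ya)_z=a_z$ for $z\ne y$ and $(\sigma^ya)_y=-a_y+\sum_{\{z,y\}\in E}a_z$. Let $\Sigma^x$ (respectively $\underline\Sigma^x$) be the composition of all $\sigma^y$ with $d(x,y)$ even (respectively odd). Put $s_0(x)=s(x)$ and, for neighbors $x,y$, $r_0(x,y)=s(x)+s(y)$. For $t\ge 0$ let $s_{t+1}(x)=\underline\Sigma^xs_t(x)$, $r_{t+1}(x,y)=\underline\Sigma^xr_t(x,y)$ if $t$ is even, and $s_{t+1}(x)=\Sigma^xs_t(x)$, $r_{t+1}(x,y)=\Sigma^xr_t(x,y)$ if $t$ is odd. Let $\Omega$ be a bipartite orientation of $(T,E)$ (every vertex is a sink or a source). If $x$ is a sink and $t$ is even, or $x$ is a source and $t$ is odd, let $P_t(x)$ and $R_t(x,y)$ denote the indecomposable $k$-linear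 representations of $(T,E,\Omega)$ (unique up to isomorphism) with dimension vectors $s_t(x)$ and $r_t(x,y)$, respectively. **Corollary 4.3.** Let $t\ge 0$ and let $x_{-1},x_0,x_1,\dots,x_{t+1}$ be a path in $(T,E)$ (consecutive vertices are neighbors and $x_{i-1}\neq x_{i+1}$ for $0\le i\le t$) such that $x_0$ is a source. For $0\le i\le t$ let $z_i$ be the neighbor of $x_i$ different from $x_{i-1}$ and $x_{i+1}$. Then the modules $P_i(z_i)$ for $0\le i\le t$, $R_{t+1}(x_t,x_{t+1})$ and $R_0(x_{-1},x_0)$ exist, and there is an exact sequence of representations of $(T,E,\Omega)$ $$0\to P_0(z_0)\oplus\cdots\oplus P_t(z_t)\to R_{t+1}(x_t,x_{t+1})\to R_0(x_{-1},x_0)\to 0 .$$ The sums of the dimensions of $P_i(z_i)$, $R_{t+1}(x_t,x_{t+1})$ and $R_0(x_{-1},x_0)$ over all sources are $f_{2i}$, $f_{2t+1}$ and $1$, and over all sinks they are $f_{2i+2}$, $f_{2t+3}$ and $1$, respectively; so the sequence categorifies the equality $f_{2t+1}=1+\sum_{i=1}^{t}f_{2i}$. -/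

import Mathlib

open CategoryTheory CategoryTheory.Limits

noncomputable section

namespace Fibonacci

universe u v

section Vectors

variable {V : Type v} (G : SimpleGraph V) [G.LocallyFinite]

/-- The basis vector `s(x)`. Integral vectors indexed by the vertices are written as functions
`V → ℤ`; all the vectors that occur below have finite support. -/
def basisVec (x : V) : V → ℤ := fun z => by
  classical exact if z = x then 1 else 0

/-- The reflection `σ^y`: it changes only the coordinate at `y`, which becomes
`- a_y + ∑ a_x`, the sum being over the neighbors `x` of `y`. -/
def reflection (y : V) (a : V → ℤ) : V → ℤ := fun x => by
  classical exact if x = y then - a y + ∑ z ∈ G.neighborFinset y, a z else a x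

/-- The composition of all the reflections `σ^y` with `y ∈ S`, where `S` is a set of pairwise
non-adjacent vertices. As such reflections commute and do not read off each other's coordinates,
all of them can be applied at the same time; see `foldr_reflection_eq`. -/
def reflectionAt (S : Set V) (a : V → ℤ) : V → ℤ := fun x => by
  classical exact if x ∈ S then - a x + ∑ z ∈ G.neighborFinset x, a z else a x

theorem foldr_reflection_apply {S : Set V} (hS : ∀ y ∈ S, ∀ z ∈ S, ¬ G.Adj y z)
    (a : V → ℤ) (l : List V) (hl : l.Nodup) (hlS : ∀ y ∈ l, y ∈ S) :
    l.foldr (reflection G) a = reflectionAt G {y | y ∈ l} a := by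
  classical
  induction l with
  | nil => funext x; simp [reflectionAt]
  | cons y l ih =>
    have hl' := List.nodup_cons.1 hl
    rw [List.foldr_cons, ih hl'.2 (fun z hz => hlS z (List.mem_cons_of_mem _ hz))]
    funext x
    by_cases hx : x = y
    · subst hx
      have : ∑ z ∈ G.neighborFinset x, reflectionAt G {y | y ∈ l} a z
          = ∑ z ∈ G.neighborFinset x, a z := by
        refine Finset.sum_congr rfl fun z hz => ?_
        have hz' : z ∉ l := fun h => hS x (hlS x (by simp)) z (hlS z (by simp [h]))
          ((G.mem_neighborFinset x z).1 hz)
        simp [reflectionAt, hz']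
      simp only [reflection, if_true, this]
      simp [reflectionAt, hl'.1]
    · simp [reflection, reflectionAt, hx]

/-- The simultaneous reflection is the composition (in any order) of the finitely many reflections
at vertices of `S` which do not fix `a`, and of any finite number of further ones. -/
theorem foldr_reflection_eq {S : Set V} (hS : ∀ y ∈ S, ∀ z ∈ S, ¬ G.Adj y z)
    (a : V → ℤ) (l : List V) (hl : l.Nodup) (hlS : ∀ y ∈ l, y ∈ S)
    (hfix : ∀ y ∈ S, y ∉ l → reflection G y a = a) :
    l.foldr (reflection G) a = reflectionAt G S a := by
  classical
  rw [foldr_reflection_apply G hS a l hl hlS]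
  funext x
  by_cases hx : x ∈ l
  · simp [reflectionAt, hx, hlS x hx]
  · by_cases hxS : x ∈ S
    · have := congrFun (hfix x hxS hx) x
      simp only [reflection, if_true] at this
      simp [reflectionAt, hx, hxS, this]
    · simp [reflectionAt, hx, hxS]

/-- `Σ^x`: reflect at all vertices of even distance from `x`. -/
def reflectEven (x : V) : (V → ℤ) → (V → ℤ) := reflectionAt G {y | Even (G.dist x y)}

/-- `\underline{Σ}^x`: reflect at all vertices of odd distance from `x`. -/
def reflectOdd (x : V) : (V → ℤ) → (V → ℤ) := reflectionAt G {y | Odd (G.dist x y)}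

/-- Starting from `a`, apply alternately `\underline{Σ}^x, Σ^x, \underline{Σ}^x, …`, altogether
`t` times. -/
def iterReflect (x : V) (a : V → ℤ) : ℕ → (V → ℤ)
  | 0 => a
  | t + 1 => if Even t then reflectOdd G x (iterReflect x a t)
      else reflectEven G x (iterReflect x a t)

/-- The Fibonacci vector `s_t(x)`. -/
def sVec (t : ℕ) (x : V) : V → ℤ := iterReflect G x (basisVec x) t

/-- The Fibonacci vector `r_t(x, y)`, where `x, y` are neighbors. -/
def rVec (t : ℕ) (x y : V) : V → ℤ := iterReflect G x (basisVec x + basisVec y) t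

end Vectors

/-- A bipartite orientation of a graph: every edge gets exactly one direction, and every vertex is a
sink (no arrow starts there) or a source (no arrow ends there). -/
structure BipartiteOrientation {V : Type v} (G : SimpleGraph V) where
  /-- `arrow a b` means that there is an arrow `a → b`. -/
  arrow : V → V → Prop
  adj_iff : ∀ a b, G.Adj a b ↔ arrow a b ∨ arrow b a
  asymm : ∀ a b, arrow a b → ¬ arrow b a
  sink_or_source : ∀ a, (∀ b, ¬ arrow a b) ∨ (∀ b, ¬ arrow b a)

namespace BipartiteOrientation

variable {V : Type v} {G : SimpleGraph V} (Ω : BipartiteOrientation G)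

def IsSink (a : V) : Prop := ∀ b, ¬ Ω.arrow a b

def IsSource (a : V) : Prop := ∀ b, ¬ Ω.arrow b a

/-- The orientation is the one for which `x` is a sink in case `t` is even, and a source in case `t`
is odd. -/
def IsOmega (t : ℕ) (x : V) : Prop := (Even t → Ω.IsSink x) ∧ (Odd t → Ω.IsSource x)

/-- The vertex set of the oriented graph, as a quiver. -/
def Vertex (_Ω : BipartiteOrientation G) : Type v := V

instance : Quiver Ω.Vertex where
  Hom a b := PLift (Ω.arrow a b)

/-- The category of representations of the quiver over `k`: functors from its path category to
`k`-modules, that is, a `k`-module for every vertex and a linear map for every arrow. -/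
abbrev Rep (k : Type u) [Field k] := Paths Ω.Vertex ⥤ ModuleCat.{u} k

instance (k : Type u) [Field k] : HasFiniteBiproducts (Ω.Rep k) :=
  HasFiniteBiproducts.of_hasFiniteProducts

variable {Ω} {k : Type u} [Field k]

/-- The vector space of a representation at the vertex `a`. -/
abbrev Rep.space (M : Ω.Rep k) (a : V) : ModuleCat.{u} k := M.obj ((Paths.of Ω.Vertex).obj a)

/-- `M` is finite-dimensional at every vertex, with dimension vector `d`. -/
def Rep.HasDimVec (M : Ω.Rep k) (d : V → ℤ) : Prop :=
  ∀ a : V, Module.Finite k (Rep.space M a) ∧ (Module.finrank k (Rep.space M a) : ℤ) = d a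

/-- The sum of the dimensions of the vector spaces of `M` at all the sources. -/
def Rep.sourceDim (M : Ω.Rep k) : ℕ :=
  ∑ᶠ (a : V) (_ : Ω.IsSource a), Module.finrank k (Rep.space M a)

/-- The sum of the dimensions of the vector spaces of `M` at all the sinks. -/
def Rep.sinkDim (M : Ω.Rep k) : ℕ :=
  ∑ᶠ (a : V) (_ : Ω.IsSink a), Module.finrank k (Rep.space M a)

variable [G.LocallyFinite]

/-- `M` is (isomorphic to) the Fibonacci module `P_t(x)`: the indecomposable representation, for the
orientation with `x` a sink for `t` even and a source for `t` odd, with dimension vector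
`s_t(x)`. -/
def Rep.IsP (t : ℕ) (x : V) (M : Ω.Rep k) : Prop :=
  Ω.IsOmega t x ∧ Indecomposable M ∧ Rep.HasDimVec M (sVec G t x)

/-- `M` is (isomorphic to) the Fibonacci module `R_t(x, y)`, where `x, y` are neighbors: the
indecomposable representation, for the orientation with `x` a sink for `t` even and a source for `t`
odd, with dimension vector `r_t(x, y)`. -/
def Rep.IsR (t : ℕ) (x y : V) (M : Ω.Rep k) : Prop :=
  G.Adj x y ∧ Ω.IsOmega t x ∧ Indecomposable M ∧ Rep.HasDimVec M (rVec G t x y)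

end BipartiteOrientation

end Fibonacci

end

/-!
The Fibonacci modules are built by the reflection functors of Bernstein, Gelfand and Ponomarev. If
`Ω.op` is the opposite of the bipartite orientation `Ω`, then the reflections at all sinks of `Ω` at
once lead from representations of `Ω` to representations of `Ω.op`, and the reflections at the
sources of `Ω.op` lead back. This is encoded by a relation `IsReflection N M e`: away from the sinks
of `Ω`, the spaces of `N` and `M` agree, and at every sink `y` there is an exact sequence
`0 → N y → ⨁ N z → M y → 0` over the neighbors `z` of `y`. Such reflections identify
endomorphism rings, hence preserve indecomposability (`IsReflection.indecomposable_iff`), they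
change dimension vectors as expected (`IsReflection.hasDimVec`), and they preserve exact sequences
by the nine lemma (`Rep.IsExactSeq.reflect`). An indecomposable representation which does not live
at a single vertex always has reflections, because the cokernel at a sink, or the kernel at a source,
would split off (`Rep.inMap_surjective`, `Rep.outMap_injective`). So `P_{t+1}(x)` and `R_{t+1}(x, y)`
are precisely the reflections of `P_t(x)` and `R_t(x, y)`; this gives their existence, and replaces
their uniqueness. The sums over sinks and sources are computed along the way: a reflection at the
sinks turns the pair of sums `(A, B)` over the old sources and sinks into `(B, 3 B - A)`, by
double counting (`HasSums.reflect`), and this is the recursion of every second Fibonacci number.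

The exact sequence is obtained by induction on the length of the path (`exists_isExactSeq`). By
induction, there is the sequence for the path without its first vertex and the opposite
orientation, and its reflection is
`0 → P_1(z_1) ⊕ ⋯ ⊕ P_t(z_t) → R_{t+1}(x_t, x_{t+1}) → R_1(x_0, x_1) → 0`. The module
`R_1(x_0, x_1)` has dimension `1` at `x_{-1}`, `x_0` and `z_0`, so that `R_0(x_{-1}, x_0)` is a factor
of it (`exists_hom_of_reflection`), and the kernel is the simple module `P_0(z_0)`. As `z_0` is a
sink, `P_0(z_0)` is projective; it lifts to `R_{t+1}(x_t, x_{t+1})`, and the kernel of the composed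
surjection is the direct sum (`Rep.IsExactSeq.extend`). No first extension groups are needed.
-/

noncomputable section

namespace Fibonacci

namespace BipartiteOrientation

universe u v

/-! ### Representations as families of linear maps -/

section Families

variable {V : Type v} {G : SimpleGraph V} {Ω : BipartiteOrientation G} {k : Type u} [Field k]

/-- An object of an abelian category is indecomposable if and only if it is nonzero and has no
idempotent endomorphisms besides `0` and `1`, because idempotents split. -/
theorem indecomposable_iff_idempotent {C : Type*} [Category C] [Abelian C] (M : C) :
    Indecomposable M ↔ ¬ IsZero M ∧ ∀ e : M ⟶ M, e ≫ e = e → e = 0 ∨ e = 𝟙 M := by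
  constructor
  · rintro ⟨h0, h⟩
    refine ⟨h0, fun e he => ?_⟩
    have he' : (𝟙 M - e) ≫ (𝟙 M - e) = 𝟙 M - e := by
      simp [he]
    obtain ⟨Y, i, p, hip, hpi⟩ := IsIdempotentComplete.idempotents_split M e he
    obtain ⟨Z, j, q, hjq, hqj⟩ := IsIdempotentComplete.idempotents_split M (𝟙 M - e) he'
    have hiq : i ≫ q = 0 := by
      calc i ≫ q = (i ≫ p) ≫ (i ≫ q) ≫ (j ≫ q) := by rw [hip, hjq]; simp
        _ = i ≫ (p ≫ i) ≫ (q ≫ j) ≫ q := by simp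
        _ = 0 := by rw [hpi, hqj, ← Category.assoc e]; simp [he]
    have hjp : j ≫ p = 0 := by
      calc j ≫ p = (j ≫ q) ≫ (j ≫ p) ≫ (i ≫ p) := by rw [hip, hjq]; simp
        _ = j ≫ (q ≫ j) ≫ (p ≫ i) ≫ p := by simp
        _ = 0 := by rw [hpi, hqj, ← Category.assoc (𝟙 M - e)]; simp [he]
    let iso : M ≅ Y ⊞ Z :=
      { hom := biprod.lift p q
        inv := biprod.desc i j
        hom_inv_id := by simp [biprod.lift_desc, hpi, hqj]
        inv_hom_id := by
          ext <;> simp [hip, hiq, hjp, hjq] }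
    rcases h Y Z iso with hY | hZ
    · left
      rw [← hpi, hY.eq_of_tgt p 0, zero_comp]
    · right
      have : 𝟙 M - e = 0 := by rw [← hqj, hZ.eq_of_tgt q 0, zero_comp]
      exact (sub_eq_zero.1 this).symm
  · rintro ⟨h0, h⟩
    refine ⟨h0, fun Y Z i => ?_⟩
    have he : (i.hom ≫ biprod.fst ≫ biprod.inl ≫ i.inv) ≫
        (i.hom ≫ biprod.fst ≫ biprod.inl ≫ i.inv) = i.hom ≫ biprod.fst ≫ biprod.inl ≫ i.inv := by
      simp
    rcases h _ he with h1 | h1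
    · left
      rw [IsZero.iff_id_eq_zero]
      calc 𝟙 Y = biprod.inl ≫ i.inv ≫ (i.hom ≫ biprod.fst ≫ biprod.inl ≫ i.inv) ≫
          i.hom ≫ biprod.fst := by simp
        _ = 0 := by rw [h1]; simp
    · right
      rw [IsZero.iff_id_eq_zero]
      calc 𝟙 Z = biprod.inr ≫ i.inv ≫ 𝟙 M ≫ i.hom ≫ biprod.snd := by simp
        _ = 0 := by rw [← h1]; simp

/-- A family of morphisms which is natural for the arrows of a quiver is natural for its paths. -/
theorem exists_natTrans_of_arrows {W C : Type*} [Quiver W] [Category C] (F H : Paths W ⥤ C)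
    (app : ∀ a : Paths W, F.obj a ⟶ H.obj a)
    (h : ∀ (a b : W) (q : a ⟶ b), F.map ((Paths.of W).map q) ≫ app ((Paths.of W).obj b) =
      app ((Paths.of W).obj a) ≫ H.map ((Paths.of W).map q)) :
    ∃ ψ : F ⟶ H, ∀ a, ψ.app a = app a := by
  refine ⟨{ app := app, naturality := fun a b p => ?_ }, fun a => rfl⟩
  induction p using Paths.induction with
  | id => simp
  | comp p q hp =>
    rw [F.map_comp, H.map_comp, Category.assoc, h, ← Category.assoc, hp, Category.assoc]

/-- The linear map of a representation along the arrow `a → b`. It is defined for all pairs of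
vertices, with the value `0` when there is no arrow from `a` to `b`. -/
def Rep.arr (M : Ω.Rep k) (a b : V) : Rep.space M a →ₗ[k] Rep.space M b := by
  classical exact if h : Ω.arrow a b then
    (M.map (Quiver.Hom.toPath (V := Ω.Vertex) (a := a) (b := b) ⟨h⟩)).hom else 0

/-- The component at the vertex `a` of a morphism of representations. -/
def Rep.lin {M N : Ω.Rep k} (φ : M ⟶ N) (a : V) : Rep.space M a →ₗ[k] Rep.space N a :=
  (φ.app ((Paths.of Ω.Vertex).obj a)).hom

theorem Rep.arr_of_arrow (M : Ω.Rep k) {a b : V} (h : Ω.arrow a b) :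
    Rep.arr M a b = (M.map (Quiver.Hom.toPath (V := Ω.Vertex) (a := a) (b := b) ⟨h⟩)).hom := by
  exact dif_pos h

theorem Rep.arr_of_not (M : Ω.Rep k) {a b : V} (h : ¬ Ω.arrow a b) : Rep.arr M a b = 0 := by
  simp [Rep.arr, h]

/-- There is a representation with given vector spaces and linear maps; only the maps along arrows
matter. -/
theorem Rep.exists_arr_eq (X : V → Type u) [∀ a, AddCommGroup (X a)] [∀ a, Module k (X a)]
    (f : ∀ a b, X a →ₗ[k] X b) : ∃ (M : Ω.Rep k) (E : ∀ a, X a ≃ₗ[k] Rep.space M a),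
      ∀ a b, Ω.arrow a b → ∀ v, Rep.arr M a b (E a v) = E b (f a b v) := by
  let F : Ω.Vertex ⥤q ModuleCat.{u} k :=
    { obj := fun a : V => ModuleCat.of k (X a), map := fun {a b : V} _ => ModuleCat.ofHom (f a b) }
  refine ⟨Paths.lift F, fun a => LinearEquiv.refl k (X a), fun a b h v => ?_⟩
  rw [Rep.arr_of_arrow _ h]
  exact LinearMap.congr_fun (congrArg ModuleCat.Hom.hom
    (Paths.lift_toPath F (X := a) (Y := b) ⟨h⟩)) v

theorem Rep.lin_arr {M N : Ω.Rep k} (φ : M ⟶ N) (a b : V) (v : Rep.space M a) :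
    Rep.lin φ b (Rep.arr M a b v) = Rep.arr N a b (Rep.lin φ a v) := by
  by_cases h : Ω.arrow a b
  · rw [Rep.arr_of_arrow _ h, Rep.arr_of_arrow _ h]
    exact congrArg (fun f => f.hom v)
      (φ.naturality (Quiver.Hom.toPath (V := Ω.Vertex) (a := a) (b := b) ⟨h⟩))
  · simp [Rep.arr_of_not _ h]

/-- A family of linear maps which is compatible with the arrows is a morphism. -/
theorem Rep.exists_lin_eq {M N : Ω.Rep k} (φ : ∀ a, Rep.space M a →ₗ[k] Rep.space N a)
    (h : ∀ a b, Ω.arrow a b → ∀ v, φ b (Rep.arr M a b v) = Rep.arr N a b (φ a v)) :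
    ∃ ψ : M ⟶ N, ∀ a, Rep.lin ψ a = φ a := by
  obtain ⟨ψ, hψ⟩ := exists_natTrans_of_arrows M N (fun a => ModuleCat.ofHom (φ a)) (by
    intro a b q
    refine ModuleCat.hom_ext (LinearMap.ext fun v => ?_)
    have := h a b q.down v
    rw [Rep.arr_of_arrow _ q.down, Rep.arr_of_arrow _ q.down] at this
    exact this)
  exact ⟨ψ, fun a => congrArg ModuleCat.Hom.hom (hψ a)⟩

theorem Rep.hom_ext_lin {M N : Ω.Rep k} {φ ψ : M ⟶ N} (h : ∀ a, Rep.lin φ a = Rep.lin ψ a) :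
    φ = ψ := by
  ext a : 2
  exact ModuleCat.hom_ext (h a)

@[simp] theorem Rep.lin_zero {M N : Ω.Rep k} (a : V) : Rep.lin (0 : M ⟶ N) a = 0 := rfl

@[simp] theorem Rep.lin_id (M : Ω.Rep k) (a : V) : Rep.lin (𝟙 M) a = LinearMap.id := rfl

@[simp] theorem Rep.lin_comp {L M N : Ω.Rep k} (φ : L ⟶ M) (ψ : M ⟶ N) (a : V) :
    Rep.lin (φ ≫ ψ) a = Rep.lin ψ a ∘ₗ Rep.lin φ a := rfl

@[simp] theorem Rep.lin_sub {M N : Ω.Rep k} (φ ψ : M ⟶ N) (a : V) :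
    Rep.lin (φ - ψ) a = Rep.lin φ a - Rep.lin ψ a := rfl

@[simp] theorem Rep.lin_sum {M N : Ω.Rep k} {ι : Type*} (s : Finset ι) (φ : ι → (M ⟶ N)) (a : V) :
    Rep.lin (∑ i ∈ s, φ i) a = ∑ i ∈ s, Rep.lin (φ i) a := by
  classical
  induction s using Finset.induction_on with
  | empty => simp
  | insert i s hi ih => rw [Finset.sum_insert hi, Finset.sum_insert hi, ← ih]; rfl

theorem Rep.isZero_iff (M : Ω.Rep k) : IsZero M ↔ ∀ a : V, Subsingleton (Rep.space M a) := by
  rw [Functor.isZero_iff]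
  exact forall_congr' fun a => ModuleCat.isZero_iff_subsingleton

theorem Rep.indecomposable_iff (M : Ω.Rep k) : Indecomposable M ↔ ¬ IsZero M ∧
    ∀ e : M ⟶ M, e ≫ e = e → e = 0 ∨ e = 𝟙 M :=
  indecomposable_iff_idempotent M

/-- The sequence `0 → ⨁ P i → R → S → 0` given by `f i : P i ⟶ R` and `g : R ⟶ S` is exact; the
condition is spelled out for the elements at every vertex. -/
structure Rep.IsExactSeq {ι : Type} [Fintype ι] {P : ι → Ω.Rep k} {R S : Ω.Rep k}
    (f : ∀ i, P i ⟶ R) (g : R ⟶ S) : Prop where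
  inj : ∀ (a : V) (p : ∀ i, Rep.space (P i) a), ∑ i, Rep.lin (f i) a (p i) = 0 → p = 0
  exact : ∀ (a : V) (r : Rep.space R a),
    Rep.lin g a r = 0 ↔ ∃ p : ∀ i, Rep.space (P i) a, ∑ i, Rep.lin (f i) a (p i) = r
  surj : ∀ a : V, Function.Surjective (Rep.lin g a)

theorem Rep.IsExactSeq.exists_shortExact {n : ℕ} {P : Fin n → Ω.Rep k} {R S : Ω.Rep k}
    {f : ∀ i, P i ⟶ R} {g : R ⟶ S} (h : Rep.IsExactSeq f g) :
    ∃ (f : (⨁ P) ⟶ R) (g : R ⟶ S) (w : f ≫ g = 0), (ShortComplex.mk f g w).ShortExact := by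
  classical
  -- an element of the biproduct at a vertex is the tuple of its projections
  have hx : ∀ (a : V) (x : Rep.space (⨁ P) a),
      x = ∑ i, Rep.lin (biproduct.ι P i) a (Rep.lin (biproduct.π P i) a x) := by
    intro a x
    have := congrArg (fun φ => Rep.lin φ a x) (biproduct.total (f := P))
    rw [Rep.lin_sum, Rep.lin_id, LinearMap.sum_apply] at this
    exact this.symm
  have hp : ∀ (a : V) (p : ∀ i, Rep.space (P i) a) (j : Fin n),
      Rep.lin (biproduct.π P j) a (∑ i, Rep.lin (biproduct.ι P i) a (p i)) = p j := by
    intro a p j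
    rw [map_sum, Finset.sum_eq_single j]
    · have := congrArg (fun φ => Rep.lin φ a (p j)) (biproduct.ι_π_self P j)
      exact this
    · intro i _ hij
      have := congrArg (fun φ => Rep.lin φ a (p i)) (biproduct.ι_π_ne P hij)
      exact this
    · simp
  have hd : ∀ (a : V) (p : ∀ i, Rep.space (P i) a), Rep.lin (biproduct.desc f) a
      (∑ i, Rep.lin (biproduct.ι P i) a (p i)) = ∑ i, Rep.lin (f i) a (p i) := by
    intro a p
    rw [map_sum]
    refine Finset.sum_congr rfl fun i _ => ?_
    have := congrArg (fun φ => Rep.lin φ a (p i)) (biproduct.ι_desc f i)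
    exact this
  have w : biproduct.desc f ≫ g = 0 := by
    refine Rep.hom_ext_lin fun a => LinearMap.ext fun x => ?_
    rw [hx a x, Rep.lin_comp, LinearMap.comp_apply, hd]
    exact (h.exact a _).2 ⟨_, rfl⟩
  have hinj : ∀ a, Function.Injective (Rep.lin (biproduct.desc f) a) := by
    intro a
    rw [injective_iff_map_eq_zero]
    intro x h0
    rw [hx a x, hd] at h0
    have := h.inj a _ h0
    rw [hx a x]
    refine Finset.sum_eq_zero fun i _ => ?_
    rw [show Rep.lin (biproduct.π P i) a x = 0 from congrFun this i, map_zero]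
  refine ⟨biproduct.desc f, g, w, ?_⟩
  have hmono : Mono (biproduct.desc f) := by
    rw [NatTrans.mono_iff_mono_app]
    intro a
    rw [ModuleCat.mono_iff_injective]
    exact hinj a
  have hepi : Epi g := by
    rw [NatTrans.epi_iff_epi_app]
    intro a
    rw [ModuleCat.epi_iff_surjective]
    exact h.surj a
  refine ShortComplex.ShortExact.mk' ?_ hmono hepi
  rw [ShortComplex.exact_iff_isZero_homology, Functor.isZero_iff]
  intro a
  let S := ShortComplex.mk (biproduct.desc f) g w
  refine IsZero.of_iso ?_ (S.mapHomologyIso ((evaluation _ _).obj a)).symm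
  rw [← ShortComplex.exact_iff_isZero_homology, ShortComplex.moduleCat_exact_iff]
  intro r hr
  obtain ⟨p, hp⟩ := (h.exact a r).1 hr
  exact ⟨∑ i, Rep.lin (biproduct.ι P i) a (p i), (hd a p).trans hp⟩

end Families

/-! ### The opposite orientation and reflections of representations -/

section Factor

variable {k : Type*} [Field k] {A B C : Type*} [AddCommGroup A] [AddCommGroup B] [AddCommGroup C]
  [Module k A] [Module k B] [Module k C]

theorem exists_factor_of_surjective (p : A →ₗ[k] B) (q : A →ₗ[k] C)
    (hp : Function.Surjective p) (h : ∀ a, p a = 0 → q a = 0) :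
    ∃ r : B →ₗ[k] C, ∀ a, r (p a) = q a := by
  obtain ⟨s, hs⟩ := p.exists_rightInverse_of_surjective (LinearMap.range_eq_top.2 hp)
  refine ⟨q ∘ₗ s, fun a => sub_eq_zero.1 ?_⟩
  rw [LinearMap.comp_apply, ← map_sub]
  apply h
  rw [map_sub, sub_eq_zero]
  exact LinearMap.congr_fun hs (p a)

theorem exists_lift_of_injective (j : B →ₗ[k] C) (q : A →ₗ[k] C)
    (hj : Function.Injective j) (h : ∀ a, ∃ b, j b = q a) :
    ∃ r : A →ₗ[k] B, ∀ a, j (r a) = q a := by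
  obtain ⟨s, hs⟩ := j.exists_leftInverse_of_injective (LinearMap.ker_eq_bot.2 hj)
  refine ⟨s ∘ₗ q, fun a => ?_⟩
  obtain ⟨b, hb⟩ := h a
  rw [LinearMap.comp_apply, ← hb]
  exact congrArg j (LinearMap.congr_fun hs b)

end Factor

section Reflection

variable {V : Type v} {G : SimpleGraph V}

/-- The orientation obtained by reversing all arrows. -/
def op (Ω : BipartiteOrientation G) : BipartiteOrientation G where
  arrow a b := Ω.arrow b a
  adj_iff a b := (Ω.adj_iff a b).trans or_comm
  asymm a b h h' := Ω.asymm a b h' h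
  sink_or_source a := (Ω.sink_or_source a).symm

variable {Ω : BipartiteOrientation G}

theorem IsSource.of_arrow {a b : V} (h : Ω.arrow a b) : Ω.IsSource a :=
  (Ω.sink_or_source a).resolve_left fun h' => h' b h

theorem IsSink.of_arrow {a b : V} (h : Ω.arrow a b) : Ω.IsSink b :=
  (Ω.sink_or_source b).resolve_right fun h' => h' a h

theorem IsSink.arrow {y z : V} (hy : Ω.IsSink y) (h : G.Adj y z) : Ω.arrow z y :=
  ((Ω.adj_iff y z).1 h).resolve_left (hy z)

theorem IsSource.arrow {y z : V} (hy : Ω.IsSource y) (h : G.Adj y z) : Ω.arrow y z :=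
  ((Ω.adj_iff y z).1 h).resolve_right (hy z)

theorem IsSink.not_isSink_of_adj {y z : V} (hy : Ω.IsSink y) (h : G.Adj y z) : ¬ Ω.IsSink z :=
  fun hz => hz y (hy.arrow h)

theorem adj_of_arrow {a b : V} (h : Ω.arrow a b) : G.Adj a b := (Ω.adj_iff a b).2 (Or.inl h)

variable {k : Type u} [Field k]

theorem Rep.lin_lin_of_comp_self {M : Ω.Rep k} {φ : M ⟶ M} (h : φ ≫ φ = φ) (a : V)
    (v : Rep.space M a) : Rep.lin φ a (Rep.lin φ a v) = Rep.lin φ a v := by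
  rw [← LinearMap.comp_apply, ← Rep.lin_comp, h]

/-- The map from the space at `y` to the product of the spaces at the neighbors of `y`. -/
def Rep.outMap (M : Ω.Rep k) (y : V) :
    Rep.space M y →ₗ[k] (∀ z : G.neighborSet y, Rep.space M z) :=
  LinearMap.pi fun z => Rep.arr M y z

@[simp] theorem Rep.outMap_apply (M : Ω.Rep k) (y : V) (n : Rep.space M y) (z : G.neighborSet y) :
    Rep.outMap M y n z = Rep.arr M y z n := rfl

variable [G.LocallyFinite]

/-- The map into the space at `y` from the product of the spaces at the neighbors of `y`. -/
def Rep.inMap (M : Ω.Rep k) (y : V) :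
    (∀ z : G.neighborSet y, Rep.space M z) →ₗ[k] Rep.space M y :=
  ∑ z : G.neighborSet y, Rep.arr M z y ∘ₗ LinearMap.proj z

theorem Rep.inMap_apply (M : Ω.Rep k) (y : V) (v : ∀ z : G.neighborSet y, Rep.space M z) :
    Rep.inMap M y v = ∑ z : G.neighborSet y, Rep.arr M z y (v z) := by
  simp [Rep.inMap]

theorem Rep.inMap_map_single (M : Ω.Rep k) {y : V} [DecidableEq (G.neighborSet y)] {X : V → Type*}
    [∀ a, AddCommGroup (X a)] [∀ a, Module k (X a)] (g : ∀ a, X a →ₗ[k] Rep.space M a)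
    (z : G.neighborSet y) (w : X z) :
    Rep.inMap M y (fun b => g b (Pi.single (M := fun b : G.neighborSet y => X b) z w b)) =
      Rep.arr M z y (g z w) := by
  rw [Rep.inMap_apply, Finset.sum_eq_single z]
  · simp
  · intro b _ hb
    rw [Pi.single_eq_of_ne hb, map_zero, map_zero]
  · simp

theorem Rep.lin_inMap {M N : Ω.Rep k} (φ : M ⟶ N) (y : V)
    (v : ∀ z : G.neighborSet y, Rep.space M z) :
    Rep.lin φ y (Rep.inMap M y v) = Rep.inMap N y fun z => Rep.lin φ z (v z) := by
  simp only [Rep.inMap_apply, map_sum, Rep.lin_arr]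

/-- The representation `M` of the quiver is obtained from the representation `N` of the opposite
quiver by the reflections at all the sinks of the first quiver, and conversely. The spaces at the
other vertices are identified by `e`, whose values at the sinks play no role. At each sink `y`,
there is the exact sequence `0 → N y → ⨁ N z → M y → 0`, where `z` runs through the neighbors
of `y`: so `M y` is a cokernel and `N y` a kernel. -/
structure IsReflection (N : Ω.op.Rep k) (M : Ω.Rep k)
    (e : ∀ a, Rep.space N a →ₗ[k] Rep.space M a) : Prop where
  bij : ∀ a, ¬ Ω.IsSink a → Function.Bijective (e a)
  inj : ∀ y, Ω.IsSink y → Function.Injective (Rep.outMap N y)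
  surj : ∀ y, Ω.IsSink y → Function.Surjective (Rep.inMap M y)
  exact : ∀ y, Ω.IsSink y → ∀ v : ∀ z : G.neighborSet y, Rep.space N z,
    Rep.inMap M y (fun z => e z (v z)) = 0 ↔ ∃ n, Rep.outMap N y n = v

namespace IsReflection

variable {N N' : Ω.op.Rep k} {M M' : Ω.Rep k} {e : ∀ a, Rep.space N a →ₗ[k] Rep.space M a}
  {e' : ∀ a, Rep.space N' a →ₗ[k] Rep.space M' a}

theorem exists_eq_inMap (h : IsReflection N M e) {y : V} (hy : Ω.IsSink y) (m : Rep.space M y) :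
    ∃ v : ∀ z : G.neighborSet y, Rep.space N z, Rep.inMap M y (fun z => e z (v z)) = m := by
  obtain ⟨w, rfl⟩ := h.surj y hy m
  choose v hv using fun z : G.neighborSet y => (h.bij z (hy.not_isSink_of_adj z.2)).2 (w z)
  exact ⟨v, congrArg _ (funext hv)⟩

/-- Morphisms can be transported along reflections at sources. -/
theorem exists_hom (h : IsReflection N M e) (h' : IsReflection N' M' e') (φ : N ⟶ N') :
    ∃ ψ : M ⟶ M', ∀ a, ¬ Ω.IsSink a → ∀ v, Rep.lin ψ a (e a v) = e' a (Rep.lin φ a v) := by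
  classical
  have key : ∀ a, ∃ r : Rep.space M a →ₗ[k] Rep.space M' a,
      (¬ Ω.IsSink a → ∀ v, r (e a v) = e' a (Rep.lin φ a v)) ∧
      (Ω.IsSink a → ∀ v : ∀ z : G.neighborSet a, Rep.space N z,
        r (Rep.inMap M a fun z => e z (v z)) =
          Rep.inMap M' a fun z => e' z (Rep.lin φ z (v z))) := by
    intro a
    by_cases ha : Ω.IsSink a
    · obtain ⟨r, hr⟩ := exists_factor_of_surjective
        (Rep.inMap M a ∘ₗ LinearMap.pi fun z => e z ∘ₗ LinearMap.proj z)
        (Rep.inMap M' a ∘ₗ LinearMap.pi fun z => e' z ∘ₗ Rep.lin φ z ∘ₗ LinearMap.proj z)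
        (fun m => h.exists_eq_inMap ha m) (by
          intro v hv
          obtain ⟨n, rfl⟩ := (h.exact a ha v).1 hv
          refine (h'.exact a ha _).2 ⟨Rep.lin φ a n, ?_⟩
          funext z
          exact (Rep.lin_arr φ a z n).symm)
      exact ⟨r, fun h => absurd ha h, fun _ v => hr v⟩
    · obtain ⟨r, hr⟩ := exists_factor_of_surjective (e a) (e' a ∘ₗ Rep.lin φ a) (h.bij a ha).2
        (fun v hv => by
          rw [(h.bij a ha).1 (hv.trans (map_zero _).symm), map_zero])
      exact ⟨r, fun _ v => hr v, fun h => absurd h ha⟩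
  choose r hr1 hr2 using key
  obtain ⟨ψ, hψ⟩ := Rep.exists_lin_eq r (by
    intro a b hab w
    have hb := IsSink.of_arrow hab
    have hba := (adj_of_arrow hab).symm
    have ha := hb.not_isSink_of_adj hba
    obtain ⟨v, rfl⟩ := (h.bij a ha).2 w
    have := hr2 b hb (Pi.single ⟨a, hba⟩ v)
    rw [Rep.inMap_map_single M e] at this
    refine this.trans ?_
    rw [hr1 a ha]
    exact Rep.inMap_map_single M' (fun a => e' a ∘ₗ Rep.lin φ a) ⟨a, hba⟩ v)
  exact ⟨ψ, fun a ha v => by rw [hψ, hr1 a ha]⟩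

/-- Morphisms can be transported along reflections at sinks. -/
theorem exists_hom_symm (h : IsReflection N M e) (h' : IsReflection N' M' e') (ψ : M ⟶ M') :
    ∃ φ : N ⟶ N', ∀ a, ¬ Ω.IsSink a → ∀ v, Rep.lin ψ a (e a v) = e' a (Rep.lin φ a v) := by
  classical
  have key : ∀ a, ∃ r : Rep.space N a →ₗ[k] Rep.space N' a,
      ¬ Ω.IsSink a → ∀ v, e' a (r v) = Rep.lin ψ a (e a v) := by
    intro a
    by_cases ha : Ω.IsSink a
    · exact ⟨0, fun h => absurd ha h⟩
    · obtain ⟨r, hr⟩ := exists_lift_of_injective (e' a) (Rep.lin ψ a ∘ₗ e a) (h'.bij a ha).1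
        (fun v => (h'.bij a ha).2 _)
      exact ⟨r, fun _ => hr⟩
  choose s hs using key
  have key : ∀ a, ∃ r : Rep.space N a →ₗ[k] Rep.space N' a, (¬ Ω.IsSink a → r = s a) ∧
      (Ω.IsSink a → ∀ n, Rep.outMap N' a (r n) = fun z : G.neighborSet a => s z (Rep.outMap N a n z)) := by
    intro a
    by_cases ha : Ω.IsSink a
    · obtain ⟨r, hr⟩ := exists_lift_of_injective (Rep.outMap N' a)
        ((LinearMap.pi fun z => s z ∘ₗ LinearMap.proj z) ∘ₗ Rep.outMap N a) (h'.inj a ha) (by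
          intro n
          refine (h'.exact a ha _).1 ?_
          have h0 := (h.exact a ha (Rep.outMap N a n)).2 ⟨n, rfl⟩
          have := Rep.lin_inMap ψ a fun z => e z (Rep.outMap N a n z)
          rw [h0, map_zero] at this
          rw [this]
          exact congrArg _ (funext fun z => hs z (ha.not_isSink_of_adj z.2) _))
      exact ⟨r, fun h => absurd ha h, fun _ => hr⟩
    · exact ⟨s a, fun _ => rfl, fun h => absurd h ha⟩
  choose r hr1 hr2 using key
  obtain ⟨φ, hφ⟩ := Rep.exists_lin_eq r (by
    intro a b hab n
    have ha : Ω.IsSink a := IsSink.of_arrow (Ω := Ω) hab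
    have hadj := (adj_of_arrow hab)
    rw [hr1 b (ha.not_isSink_of_adj hadj)]
    exact (congrFun (hr2 a ha n) (⟨b, hadj⟩ : G.neighborSet a)).symm)
  exact ⟨φ, fun a ha v => by rw [hφ, hr1 a ha, hs a ha]⟩

/-- A morphism between reflections at sources is determined by its components outside the sinks. -/
theorem hom_ext (h : IsReflection N M e) {ψ ψ' : M ⟶ M'}
    (hψ : ∀ a, ¬ Ω.IsSink a → Rep.lin ψ a = Rep.lin ψ' a) : ψ = ψ' := by
  refine Rep.hom_ext_lin fun a => ?_
  by_cases ha : Ω.IsSink a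
  · refine LinearMap.ext fun m => ?_
    obtain ⟨v, rfl⟩ := h.surj a ha m
    rw [Rep.lin_inMap, Rep.lin_inMap]
    exact congrArg _ (funext fun z => by rw [hψ z (ha.not_isSink_of_adj z.2)])
  · exact hψ a ha

theorem hom_ext_symm (h' : IsReflection N' M' e') {φ φ' : N ⟶ N'}
    (hφ : ∀ a, ¬ Ω.IsSink a → Rep.lin φ a = Rep.lin φ' a) : φ = φ' := by
  refine Rep.hom_ext_lin fun a => ?_
  by_cases ha : Ω.IsSink a
  · refine LinearMap.ext fun n => h'.inj a ha (funext fun z => ?_)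
    rw [Rep.outMap_apply, Rep.outMap_apply, ← Rep.lin_arr, ← Rep.lin_arr,
      hφ z (ha.not_isSink_of_adj z.2)]
  · exact hφ a ha

theorem isZero_iff (h : IsReflection N M e) : IsZero N ↔ IsZero M := by
  rw [Rep.isZero_iff, Rep.isZero_iff]
  constructor
  · intro h0 a
    by_cases ha : Ω.IsSink a
    · refine ⟨fun m m' => ?_⟩
      obtain ⟨v, rfl⟩ := h.exists_eq_inMap ha m
      obtain ⟨v', rfl⟩ := h.exists_eq_inMap ha m'
      rw [show v = v' from funext fun z => (h0 z).elim _ _]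
    · exact (h.bij a ha).2.subsingleton
  · intro h0 a
    by_cases ha : Ω.IsSink a
    · refine ⟨fun n n' => h.inj a ha (funext fun z => ?_)⟩
      exact (h.bij z (ha.not_isSink_of_adj z.2)).1 ((h0 z).elim _ _)
    · exact (h.bij a ha).1.subsingleton

/-- Reflections preserve indecomposability, because they identify the endomorphism rings. -/
theorem indecomposable_iff (h : IsReflection N M e) : Indecomposable N ↔ Indecomposable M := by
  rw [Rep.indecomposable_iff, Rep.indecomposable_iff, h.isZero_iff]
  refine and_congr_right fun _ => ⟨fun hN ψ hψ => ?_, fun hM φ hφ => ?_⟩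
  · obtain ⟨φ, hφ⟩ := h.exists_hom_symm h ψ
    have hφφ : φ ≫ φ = φ := h.hom_ext_symm fun a ha => LinearMap.ext fun v => (h.bij a ha).1 (by
      rw [Rep.lin_comp, LinearMap.comp_apply, ← hφ a ha, ← hφ a ha, Rep.lin_lin_of_comp_self hψ])
    refine (hN φ hφφ).imp ?_ ?_ <;> rintro rfl <;>
    · refine h.hom_ext fun a ha => LinearMap.ext fun m => ?_
      obtain ⟨v, rfl⟩ := (h.bij a ha).2 m
      rw [hφ a ha]
      simp
  · obtain ⟨ψ, hψ⟩ := h.exists_hom h φ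
    have hψψ : ψ ≫ ψ = ψ := h.hom_ext fun a ha => LinearMap.ext fun m => by
      obtain ⟨v, rfl⟩ := (h.bij a ha).2 m
      rw [Rep.lin_comp, LinearMap.comp_apply, hψ a ha, hψ a ha, Rep.lin_lin_of_comp_self hφ]
    refine (hM ψ hψψ).imp ?_ ?_ <;> rintro rfl <;>
    · refine h.hom_ext_symm fun a ha => LinearMap.ext fun v => (h.bij a ha).1 ?_
      rw [← hψ a ha]
      simp

end IsReflection

end Reflection

/-! ### Existence of reflections and their dimension vectors -/

section Existence

variable {V : Type v} {G : SimpleGraph V} {Ω : BipartiteOrientation G} {k : Type u} [Field k]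

/-- An idempotent endomorphism of an indecomposable representation which lives at one vertex is
zero, unless the representation itself lives at this vertex. -/
theorem Rep.eq_zero_of_idempotent_at {M : Ω.Rep k} (hM : Indecomposable M) {y a : V} (ha : a ≠ y)
    (hne : ¬ Subsingleton (Rep.space M a)) (p : Rep.space M y →ₗ[k] Rep.space M y)
    (hp : ∀ m, p (p m) = p m) (hin : ∀ b v, p (Rep.arr M b y v) = 0)
    (hout : ∀ c v, Rep.arr M y c (p v) = 0) : p = 0 := by
  classical
  let φ : ∀ b, Rep.space M b →ₗ[k] Rep.space M b := Function.update (fun _ => 0) y p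
  have hφy : φ y = p := Function.update_self _ _ _
  have hφ : ∀ b, b ≠ y → φ b = 0 := fun b hb => Function.update_of_ne hb _ _
  obtain ⟨ψ, hψ⟩ := Rep.exists_lin_eq φ (by
    intro b c hbc v
    have hne : b ≠ c := (adj_of_arrow hbc).ne
    by_cases hc : c = y
    · subst hc
      rw [hφy, hφ b hne, hin]
      simp
    · rw [hφ c hc]
      by_cases hb : b = y
      · subst hb
        rw [hφy, hout]
        simp
      · rw [hφ b hb]
        simp)
  have hψψ : ψ ≫ ψ = ψ := Rep.hom_ext_lin fun b => LinearMap.ext fun v => by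
    rw [Rep.lin_comp, LinearMap.comp_apply, hψ]
    by_cases hb : b = y
    · subst hb
      rw [hφy, hp]
    · rw [hφ b hb]
      simp
  rcases ((Rep.indecomposable_iff M).1 hM).2 ψ hψψ with h0 | h1
  · rw [← hφy, ← hψ, h0, Rep.lin_zero]
  · refine absurd ⟨fun m m' => ?_⟩ hne
    have : (LinearMap.id : Rep.space M a →ₗ[k] Rep.space M a) = 0 := by
      rw [← hφ a ha, ← hψ, h1, Rep.lin_id]
    rw [← LinearMap.id_apply (R := k) m, ← LinearMap.id_apply (R := k) m', this]
    simp

variable [G.LocallyFinite]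

/-- A cokernel of the map into the space at a sink would split off as a direct summand. -/
theorem Rep.inMap_surjective {M : Ω.Rep k} (hM : Indecomposable M) {y a : V} (hy : Ω.IsSink y)
    (ha : a ≠ y) (hne : ¬ Subsingleton (Rep.space M a)) : Function.Surjective (Rep.inMap M y) := by
  classical
  set W := LinearMap.range (Rep.inMap M y) with hW
  obtain ⟨s, hs⟩ := W.mkQ.exists_rightInverse_of_surjective W.range_mkQ
  have hs' : ∀ m, W.mkQ (s m) = m := LinearMap.congr_fun hs
  have hp := Rep.eq_zero_of_idempotent_at hM ha hne (s ∘ₗ W.mkQ)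
    (fun m => by simp only [LinearMap.comp_apply, hs'])
    (fun b v => by
      by_cases hb : Ω.arrow b y
      · have hmem : Rep.arr M b y v ∈ W := ⟨_, Rep.inMap_map_single M (fun _ => LinearMap.id)
          ⟨b, (adj_of_arrow hb).symm⟩ v⟩
        rw [LinearMap.comp_apply, Submodule.mkQ_apply, (Submodule.Quotient.mk_eq_zero W).2 hmem,
          map_zero]
      · simp [Rep.arr_of_not _ hb])
    (fun c v => by simp [Rep.arr_of_not _ (hy c)])
  intro m
  have h0 : W.mkQ m = 0 := by
    have := congrArg W.mkQ (LinearMap.congr_fun hp m)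
    rwa [LinearMap.comp_apply, hs', LinearMap.zero_apply, map_zero] at this
  exact (Submodule.Quotient.mk_eq_zero W).1 h0

omit [G.LocallyFinite] in
/-- A kernel of the map out of the space at a source would split off as a direct summand. -/
theorem Rep.outMap_injective {M : Ω.Rep k} (hM : Indecomposable M) {y a : V} (hy : Ω.IsSource y)
    (ha : a ≠ y) (hne : ¬ Subsingleton (Rep.space M a)) : Function.Injective (Rep.outMap M y) := by
  set K := LinearMap.ker (Rep.outMap M y) with hK
  obtain ⟨r, hr⟩ := K.subtype.exists_leftInverse_of_injective K.ker_subtype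
  have hr' : ∀ m : K, r m = m := LinearMap.congr_fun hr
  have hp := Rep.eq_zero_of_idempotent_at hM ha hne (K.subtype ∘ₗ r)
    (fun m => by simp only [LinearMap.comp_apply, Submodule.subtype_apply, hr'])
    (fun b v => by simp [Rep.arr_of_not _ (hy b)])
    (fun c v => by
      by_cases hc : Ω.arrow y c
      · exact congrFun (LinearMap.mem_ker.1 (r v).2) ⟨c, adj_of_arrow hc⟩
      · simp [Rep.arr_of_not _ hc])
  rw [← LinearMap.ker_eq_bot, ← hK, eq_bot_iff]
  intro m hm
  have := LinearMap.congr_fun hp m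
  rw [LinearMap.comp_apply, show r m = ⟨m, hm⟩ from hr' ⟨m, hm⟩] at this
  exact this

theorem exists_linearEquiv_fin (k : Type*) [Field k] (A : Type*) [AddCommGroup A] [Module k A]
    [Module.Finite k A] : ∃ n : ℕ, Nonempty (A ≃ₗ[k] (Fin n → k)) :=
  ⟨_, ⟨(Module.finBasis k A).equivFun⟩⟩

/-- The reflection at all sources. The cokernels are replaced by isomorphic spaces of column
vectors, because of the universe level of a product over neighbors. -/
theorem exists_isReflection (N : Ω.op.Rep k) [∀ a, Module.Finite k (Rep.space N a)]
    (hinj : ∀ y, Ω.IsSink y → Function.Injective (Rep.outMap N y)) :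
    ∃ (M : Ω.Rep k) (e : ∀ a, Rep.space N a →ₗ[k] Rep.space M a), IsReflection N M e := by
  classical
  have key : ∀ a, ∃ (n : ℕ) (e : Rep.space N a →ₗ[k] (Fin n → k))
      (e' : (Fin n → k) →ₗ[k] Rep.space N a)
      (q : (∀ z : G.neighborSet a, Rep.space N z) →ₗ[k] (Fin n → k)),
      (¬ Ω.IsSink a → Function.Bijective e ∧ ∀ v, e' (e v) = v) ∧
      (Ω.IsSink a → Function.Surjective q ∧ ∀ v, q v = 0 ↔ ∃ n, Rep.outMap N a n = v) := by
    intro a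
    by_cases ha : Ω.IsSink a
    · obtain ⟨n, ⟨E⟩⟩ := exists_linearEquiv_fin k
        ((∀ z : G.neighborSet a, Rep.space N z) ⧸ LinearMap.range (Rep.outMap N a))
      refine ⟨n, 0, 0, E.toLinearMap ∘ₗ Submodule.mkQ _, fun h => absurd ha h, fun _ => ⟨?_, ?_⟩⟩
      · exact E.surjective.comp (Submodule.mkQ_surjective _)
      · intro v
        rw [LinearMap.comp_apply, LinearEquiv.coe_coe, LinearEquiv.map_eq_zero_iff,
          Submodule.mkQ_apply, Submodule.Quotient.mk_eq_zero]
        rfl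
    · obtain ⟨n, ⟨E⟩⟩ := exists_linearEquiv_fin k (Rep.space N a)
      exact ⟨n, E, E.symm, 0, fun _ => ⟨E.bijective, E.symm_apply_apply⟩, fun h => absurd h ha⟩
  choose n e e' q he hq using key
  let f : ∀ a b, (Fin (n a) → k) →ₗ[k] (Fin (n b) → k) := fun a b =>
    if h : G.Adj b a then
      q b ∘ₗ LinearMap.single k (fun z : G.neighborSet b => Rep.space N z) ⟨a, h⟩ ∘ₗ e' a
    else 0
  obtain ⟨M, E, hE⟩ := Rep.exists_arr_eq (Ω := Ω) (fun a => Fin (n a) → k) f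
  have hM : ∀ {y : V}, Ω.IsSink y → ∀ v : ∀ z : G.neighborSet y, Rep.space N z,
      Rep.inMap M y (fun z => (E z).toLinearMap (e z (v z))) = E y (q y v) := by
    intro y hy v
    rw [Rep.inMap_apply]
    have : ∀ z : G.neighborSet y, Rep.arr M z y ((E z).toLinearMap (e z (v z))) =
        E y (q y (Pi.single z (v z))) := by
      intro z
      have hz : G.Adj y z := z.2
      rw [LinearEquiv.coe_coe, hE _ _ (hy.arrow hz)]
      simp only [f, hz, dif_pos, LinearMap.comp_apply]
      rw [(he z (hy.not_isSink_of_adj hz)).2]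
      rfl
    rw [Finset.sum_congr rfl fun z _ => this z, ← map_sum, ← map_sum, Finset.univ_sum_single]
  refine ⟨M, fun a => (E a).toLinearMap ∘ₗ e a, fun a ha => (E a).bijective.comp (he a ha).1, hinj,
    fun y hy m => ?_, fun y hy v => ?_⟩
  · obtain ⟨v, hv⟩ := (hq y hy).1 ((E y).symm m)
    exact ⟨_, (hM hy v).trans ((E y).eq_symm_apply.1 hv)⟩
  · refine Iff.trans ?_ ((hq y hy).2 v)
    rw [← (E y).map_eq_zero_iff, ← hM hy]
    rfl

/-- The reflection at all sinks. -/
theorem exists_isReflection_symm (M : Ω.Rep k) [∀ a, Module.Finite k (Rep.space M a)]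
    (hsurj : ∀ y, Ω.IsSink y → Function.Surjective (Rep.inMap M y)) :
    ∃ (N : Ω.op.Rep k) (e : ∀ a, Rep.space N a →ₗ[k] Rep.space M a), IsReflection N M e := by
  classical
  have key : ∀ a, ∃ (n : ℕ) (e : (Fin n → k) →ₗ[k] Rep.space M a)
      (e' : Rep.space M a →ₗ[k] (Fin n → k))
      (j : (Fin n → k) →ₗ[k] (∀ z : G.neighborSet a, Rep.space M z)),
      (¬ Ω.IsSink a → Function.Bijective e ∧ ∀ v, e' (e v) = v) ∧
      (Ω.IsSink a → Function.Injective j ∧ ∀ v, Rep.inMap M a v = 0 ↔ ∃ n, j n = v) := by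
    intro a
    by_cases ha : Ω.IsSink a
    · obtain ⟨n, ⟨E⟩⟩ := exists_linearEquiv_fin k (LinearMap.ker (Rep.inMap M a))
      refine ⟨n, 0, 0, Submodule.subtype _ ∘ₗ E.symm.toLinearMap, fun h => absurd ha h,
        fun _ => ⟨?_, fun v => ⟨fun hv => ⟨E ⟨v, hv⟩, by simp⟩, ?_⟩⟩⟩
      · exact (Submodule.subtype_injective _).comp E.symm.injective
      · rintro ⟨w, rfl⟩
        exact (E.symm w).2
    · obtain ⟨n, ⟨E⟩⟩ := exists_linearEquiv_fin k (Rep.space M a)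
      exact ⟨n, E.symm, E, 0, fun _ => ⟨E.symm.bijective, E.apply_symm_apply⟩,
        fun h => absurd h ha⟩
  choose n e e' j he hj using key
  let f : ∀ a b, (Fin (n a) → k) →ₗ[k] (Fin (n b) → k) := fun a b =>
    if h : G.Adj a b then
      e' b ∘ₗ LinearMap.proj (φ := fun z : G.neighborSet a => Rep.space M z) ⟨b, h⟩ ∘ₗ j a
    else 0
  obtain ⟨N, E, hE⟩ := Rep.exists_arr_eq (Ω := Ω.op) (fun a => Fin (n a) → k) f
  have hN : ∀ {y : V}, Ω.IsSink y → ∀ w (z : G.neighborSet y),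
      e z ((E z).symm (Rep.outMap N y (E y w) z)) = j y w z := by
    intro y hy w z
    have hz : G.Adj y z := z.2
    rw [Rep.outMap_apply, hE _ _ (hy.arrow hz), LinearEquiv.symm_apply_apply]
    simp only [f, hz, dif_pos, LinearMap.comp_apply]
    obtain ⟨v, hv⟩ := (he z (hy.not_isSink_of_adj hz)).1.2 (j y w z)
    rw [LinearMap.proj_apply, ← hv, (he z (hy.not_isSink_of_adj hz)).2]
  refine ⟨N, fun a => e a ∘ₗ (E a).symm.toLinearMap,
    fun a ha => (he a ha).1.comp (E a).symm.bijective, fun y hy w w' hw => ?_, hsurj,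
    fun y hy v => ?_⟩
  · obtain ⟨w, rfl⟩ := (E y).surjective w
    obtain ⟨w', rfl⟩ := (E y).surjective w'
    refine congrArg _ ((hj y hy).1 (funext fun z => ?_))
    rw [← hN hy, hw, hN hy]
  · rw [(hj y hy).2, (E y).surjective.exists]
    refine exists_congr fun w => ?_
    rw [funext_iff, funext_iff]
    refine forall_congr' fun z => ?_
    rw [← hN hy]
    exact (he z (hy.not_isSink_of_adj z.2)).1.1.eq_iff.trans (E z).symm.injective.eq_iff

namespace IsReflection

variable {N : Ω.op.Rep k} {M : Ω.Rep k} {e : ∀ a, Rep.space N a →ₗ[k] Rep.space M a}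

theorem finrank_eq (h : IsReflection N M e) {a : V} (ha : ¬ Ω.IsSink a) :
    Module.finrank k (Rep.space N a) = Module.finrank k (Rep.space M a) :=
  (LinearEquiv.ofBijective (e a) (h.bij a ha)).finrank_eq

theorem finrank_add_finrank (h : IsReflection N M e)
    [∀ a, Module.Finite k (Rep.space N a)] {y : V} (hy : Ω.IsSink y) :
    Module.finrank k (Rep.space N y) + Module.finrank k (Rep.space M y) =
      ∑ z ∈ G.neighborFinset y, Module.finrank k (Rep.space N z) := by
  let T : (∀ z : G.neighborSet y, Rep.space N z) →ₗ[k] Rep.space M y :=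
    Rep.inMap M y ∘ₗ LinearMap.pi fun z => e z ∘ₗ LinearMap.proj z
  have hT : Function.Surjective T := fun m => h.exists_eq_inMap hy m
  have hker : LinearMap.ker T = LinearMap.range (Rep.outMap N y) := by
    ext v
    exact h.exact y hy v
  have h1 := T.finrank_range_add_finrank_ker
  rw [LinearMap.range_eq_top.2 hT, finrank_top, hker,
    LinearMap.finrank_range_of_inj (h.inj y hy), Module.finrank_pi_fintype] at h1
  rw [add_comm, h1]
  exact (Finset.sum_subtype _ (fun z => G.mem_neighborFinset y z)
    (fun z => Module.finrank k (Rep.space N z))).symm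

theorem finite (h : IsReflection N M e) [∀ a, Module.Finite k (Rep.space N a)] (a : V) :
    Module.Finite k (Rep.space M a) := by
  by_cases ha : Ω.IsSink a
  · let T : (∀ z : G.neighborSet a, Rep.space N z) →ₗ[k] Rep.space M a :=
      Rep.inMap M a ∘ₗ LinearMap.pi fun z => e z ∘ₗ LinearMap.proj z
    exact Module.Finite.of_surjective T fun m => h.exists_eq_inMap ha m
  · exact Module.Finite.of_surjective (e a) (h.bij a ha).2

theorem finite_symm (h : IsReflection N M e) [∀ a, Module.Finite k (Rep.space M a)] (a : V) :
    Module.Finite k (Rep.space N a) := by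
  have hns : ∀ a, ¬ Ω.IsSink a → Module.Finite k (Rep.space N a) := fun a ha =>
    Module.Finite.of_injective (e a) (h.bij a ha).1
  by_cases ha : Ω.IsSink a
  · have : ∀ z : G.neighborSet a, Module.Finite k (Rep.space N z) := fun z =>
      hns z (ha.not_isSink_of_adj z.2)
    exact Module.Finite.of_injective (Rep.outMap N a) (h.inj a ha)
  · exact hns a ha

theorem hasDimVec (h : IsReflection N M e) {d : V → ℤ} (hN : Rep.HasDimVec N d) :
    Rep.HasDimVec M (reflectionAt G {y | Ω.IsSink y} d) := by
  have : ∀ a, Module.Finite k (Rep.space N a) := fun a => (hN a).1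
  refine fun a => ⟨h.finite a, ?_⟩
  by_cases ha : Ω.IsSink a
  · have h1 := h.finrank_add_finrank ha
    zify at h1
    rw [(hN a).2, Finset.sum_congr rfl fun z _ => (hN z).2] at h1
    simp only [reflectionAt, Set.mem_ofPred_eq, ha, if_true]
    linarith
  · simp only [reflectionAt, Set.mem_ofPred_eq, ha, if_false]
    rw [← h.finrank_eq ha, (hN a).2]

theorem hasDimVec_symm (h : IsReflection N M e) {d : V → ℤ}
    (hM : Rep.HasDimVec M (reflectionAt G {y | Ω.IsSink y} d)) : Rep.HasDimVec N d := by
  have : ∀ a, Module.Finite k (Rep.space M a) := fun a => (hM a).1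
  have : ∀ a, Module.Finite k (Rep.space N a) := h.finite_symm
  have hns : ∀ a, ¬ Ω.IsSink a → (Module.finrank k (Rep.space N a) : ℤ) = d a := fun a ha => by
    rw [h.finrank_eq ha, (hM a).2]
    simp only [reflectionAt, Set.mem_ofPred_eq, ha, if_false]
  refine fun a => ⟨h.finite_symm a, ?_⟩
  by_cases ha : Ω.IsSink a
  · have h1 := h.finrank_add_finrank ha
    zify at h1
    rw [(hM a).2, Finset.sum_congr rfl fun z hz =>
      hns z (ha.not_isSink_of_adj ((G.mem_neighborFinset a z).1 hz))] at h1
    simp only [reflectionAt, Set.mem_ofPred_eq, ha, if_true] at h1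
    linarith
  · exact hns a ha

end IsReflection

end Existence

/-! ### Reflections of exact sequences -/

section ExactSequences

variable {V : Type v} {G : SimpleGraph V} [G.LocallyFinite] {Ω : BipartiteOrientation G}
  {k : Type u} [Field k] {ι : Type} [Fintype ι] {N : ι → Ω.op.Rep k} {N' N'' : Ω.op.Rep k}
  {M : ι → Ω.Rep k} {M' M'' : Ω.Rep k} {e : ∀ i a, Rep.space (N i) a →ₗ[k] Rep.space (M i) a}
  {e' : ∀ a, Rep.space N' a →ₗ[k] Rep.space M' a}
  {e'' : ∀ a, Rep.space N'' a →ₗ[k] Rep.space M'' a}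

/-- Reflections at sources preserve exact sequences, as long as their defining sequences are exact;
this is the nine lemma at every sink. -/
theorem Rep.IsExactSeq.reflect {f : ∀ i, N i ⟶ N'} {g : N' ⟶ N''} (hfg : Rep.IsExactSeq f g)
    (h : ∀ i, IsReflection (N i) (M i) (e i)) (h' : IsReflection N' M' e')
    (h'' : IsReflection N'' M'' e'') {F : ∀ i, M i ⟶ M'} {g' : M' ⟶ M''}
    (hF : ∀ i a, ¬ Ω.IsSink a → ∀ v, Rep.lin (F i) a (e i a v) = e' a (Rep.lin (f i) a v))
    (hg' : ∀ a, ¬ Ω.IsSink a → ∀ v, Rep.lin g' a (e' a v) = e'' a (Rep.lin g a v)) :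
    Rep.IsExactSeq F g' := by
  have hsum : ∀ a, ¬ Ω.IsSink a → ∀ p : ∀ i, Rep.space (N i) a,
      ∑ i, Rep.lin (F i) a (e i a (p i)) = e' a (∑ i, Rep.lin (f i) a (p i)) := by
    intro a ha p
    rw [map_sum]
    exact Finset.sum_congr rfl fun i _ => hF i a ha _
  have hgs : ∀ {y : V}, Ω.IsSink y → ∀ v : ∀ z : G.neighborSet y, Rep.space N' z,
      Rep.lin g' y (Rep.inMap M' y fun z => e' z (v z)) =
        Rep.inMap M'' y fun z => e'' z (Rep.lin g z (v z)) := by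
    intro y hy v
    rw [Rep.lin_inMap]
    exact congrArg _ (funext fun z => hg' z (hy.not_isSink_of_adj z.2) _)
  have hsums : ∀ {y : V}, Ω.IsSink y → ∀ p : ∀ i, ∀ z : G.neighborSet y, Rep.space (N i) z,
      ∑ i, Rep.lin (F i) y (Rep.inMap (M i) y fun z => e i z (p i z)) =
        Rep.inMap M' y fun z => e' z (∑ i, Rep.lin (f i) z (p i z)) := by
    intro y hy p
    simp_rw [Rep.lin_inMap]
    rw [← map_sum]
    refine congrArg _ (funext fun z => ?_)
    rw [Finset.sum_apply]
    exact hsum z (hy.not_isSink_of_adj z.2) fun i => p i z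
  have hgf : ∀ a (p : ∀ i, Rep.space (N i) a),
      Rep.lin g a (∑ i, Rep.lin (f i) a (p i)) = 0 := fun a p => (hfg.exact a _).2 ⟨p, rfl⟩
  refine ⟨fun a m hm => ?_, fun a m' => ⟨fun hm => ?_, ?_⟩, fun a m'' => ?_⟩
  · by_cases ha : Ω.IsSink a
    · choose p hp using fun i => (h i).exists_eq_inMap ha (m i)
      simp_rw [← hp] at hm
      rw [hsums ha] at hm
      obtain ⟨n', hn'⟩ := (h'.exact a ha _).1 hm
      have hz : Rep.lin g a n' = 0 := by
        refine h''.inj a ha (funext fun z => ?_)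
        rw [Rep.outMap_apply, ← Rep.lin_arr, ← Rep.outMap_apply N' a n' z, hn', hgf, map_zero]
        rfl
      obtain ⟨n, hn⟩ := (hfg.exact a n').1 hz
      have hpn : ∀ z : G.neighborSet a, (fun i => p i z - Rep.outMap (N i) a (n i) z) = 0 := by
        intro z
        refine hfg.inj z _ ?_
        simp_rw [map_sub, Finset.sum_sub_distrib, Rep.outMap_apply, Rep.lin_arr]
        rw [← map_sum, hn, ← Rep.outMap_apply N' a n' z, hn', sub_self]
      funext i
      rw [← hp i]
      exact ((h i).exact a ha _).2 ⟨n i, funext fun z =>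
        (sub_eq_zero.1 (congrFun (hpn z) i)).symm⟩
    · choose p hp using fun i => ((h i).bij a ha).2 (m i)
      simp_rw [← hp] at hm
      rw [hsum a ha] at hm
      have := hfg.inj a p ((h'.bij a ha).1 (hm.trans (map_zero _).symm))
      funext i
      rw [← hp i, this, Pi.zero_apply, map_zero]
      rfl
  · by_cases ha : Ω.IsSink a
    · obtain ⟨v', rfl⟩ := h'.exists_eq_inMap ha m'
      rw [hgs ha] at hm
      obtain ⟨n'', hn''⟩ := (h''.exact a ha _).1 hm
      obtain ⟨n', rfl⟩ := hfg.surj a n''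
      have hz : ∀ z : G.neighborSet a, ∃ p : ∀ i, Rep.space (N i) z,
          ∑ i, Rep.lin (f i) z (p i) = v' z - Rep.outMap N' a n' z := by
        intro z
        refine (hfg.exact z _).1 ?_
        rw [map_sub, Rep.outMap_apply, Rep.lin_arr, ← Rep.outMap_apply, hn'', sub_self]
      choose p hp using hz
      refine ⟨fun i => Rep.inMap (M i) a fun z => e i z (p z i), ?_⟩
      rw [hsums ha fun i z => p z i]
      simp_rw [hp, map_sub]
      have h0 := (h'.exact a ha _).2 ⟨n', rfl⟩
      exact (map_sub (Rep.inMap M' a) (fun z : G.neighborSet a => e' z (v' z)) _).trans (by rw [h0, sub_zero])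
    · obtain ⟨v', rfl⟩ := (h'.bij a ha).2 m'
      rw [hg' a ha] at hm
      obtain ⟨p, rfl⟩ := (hfg.exact a v').1 ((h''.bij a ha).1 (hm.trans (map_zero _).symm))
      exact ⟨fun i => e i a (p i), hsum a ha p⟩
  · rintro ⟨m, rfl⟩
    by_cases ha : Ω.IsSink a
    · choose p hp using fun i => (h i).exists_eq_inMap ha (m i)
      simp_rw [← hp]
      rw [hsums ha, hgs ha]
      simp_rw [hgf, map_zero]
      exact map_zero _
    · choose p hp using fun i => ((h i).bij a ha).2 (m i)
      simp_rw [← hp]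
      rw [hsum a ha, hg' a ha, hgf, map_zero]
  · by_cases ha : Ω.IsSink a
    · obtain ⟨v'', rfl⟩ := h''.exists_eq_inMap ha m''
      choose v' hv' using fun z : G.neighborSet a => hfg.surj z (v'' z)
      exact ⟨_, (hgs ha v').trans (by simp_rw [hv'])⟩
    · obtain ⟨v'', rfl⟩ := (h''.bij a ha).2 m''
      obtain ⟨v', rfl⟩ := hfg.surj a v''
      exact ⟨_, hg' a ha v'⟩

end ExactSequences

/-! ### Sums of the Fibonacci vectors over sinks and over sources -/

section Sums

variable {V : Type v} {G : SimpleGraph V} {Ω : BipartiteOrientation G}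

theorem not_isSink_and_isSource (hV : ∀ a, ∃ b, G.Adj a b) (a : V) :
    ¬ (Ω.IsSink a ∧ Ω.IsSource a) := by
  rintro ⟨h, h'⟩
  obtain ⟨b, hb⟩ := hV a
  exact h b (h'.arrow hb)

theorem not_isSink_iff (hV : ∀ a, ∃ b, G.Adj a b) (a : V) : ¬ Ω.IsSink a ↔ Ω.IsSource a :=
  ⟨(Ω.sink_or_source a).resolve_left, fun h h' => not_isSink_and_isSource hV a ⟨h', h⟩⟩

theorem even_dist_iff (hG : G.Connected) (x y : V) :
    Even (G.dist x y) ↔ (Ω.IsSink x ↔ Ω.IsSink y) := by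
  classical
  let c : G.Coloring Bool := SimpleGraph.Coloring.mk (fun a => decide (Ω.IsSink a)) (by
    intro a b hab h
    rw [decide_eq_decide] at h
    rcases (Ω.adj_iff a b).1 hab with h' | h'
    · exact (IsSink.of_arrow h').not_isSink_of_adj hab.symm (h.2 (IsSink.of_arrow h'))
    · exact (IsSink.of_arrow h').not_isSink_of_adj hab (h.1 (IsSink.of_arrow h')))
  obtain ⟨p, hp⟩ := hG.exists_walk_length_eq_dist x y
  rw [← hp, c.even_length_iff_congr p]
  change (decide (Ω.IsSink x) = true ↔ decide (Ω.IsSink y) = true) ↔ _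
  rw [decide_eq_true_iff, decide_eq_true_iff]

theorem isOmega_op_iff (t : ℕ) (x : V) : Ω.op.IsOmega t x ↔ Ω.IsOmega (t + 1) x := by
  unfold IsOmega
  rw [Nat.even_add_one, Nat.odd_add_one, Nat.not_even_iff_odd, Nat.not_odd_iff_even]
  exact and_comm

variable [G.LocallyFinite]

/-- The reflections which lead from step `t` to step `t + 1` are those at the sinks. -/
theorem iterReflect_succ (hV : ∀ a, ∃ b, G.Adj a b) (hG : G.Connected) {t : ℕ} {x : V}
    (h : Ω.IsOmega (t + 1) x) (d : V → ℤ) :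
    iterReflect G x d (t + 1) = reflectionAt G {y | Ω.IsSink y} (iterReflect G x d t) := by
  rw [iterReflect]
  split_ifs with ht
  · have hx := (not_isSink_iff hV x).2 (h.2 ht.add_one)
    refine congrArg (fun S => reflectionAt G S _) (Set.ext fun y => ?_)
    change Odd _ ↔ Ω.IsSink y
    rw [← Nat.not_even_iff_odd, even_dist_iff (Ω := Ω) hG]
    tauto
  · have hx := h.1 (Nat.not_even_iff_odd.1 ht).add_one
    refine congrArg (fun S => reflectionAt G S _) (Set.ext fun y => ?_)
    change Even _ ↔ Ω.IsSink y
    rw [even_dist_iff (Ω := Ω) hG]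
    tauto

open Classical in
/-- The vector `d` has finite support, the sum `A` over all sources and the sum `B` over all
sinks. -/
def HasSums (Ω : BipartiteOrientation G) (d : V → ℤ) (A B : ℤ) : Prop :=
  ∃ F : Finset V, (∀ a, a ∉ F → d a = 0) ∧
    (∑ a ∈ F, if Ω.IsSource a then d a else 0) = A ∧ (∑ a ∈ F, if Ω.IsSink a then d a else 0) = B

omit [G.LocallyFinite] in
theorem HasSums.exists_ne_zero {d : V → ℤ} {A B : ℤ} (h : Ω.HasSums d A B) (hB : B ≠ 0) :
    ∃ a, Ω.IsSink a ∧ d a ≠ 0 := by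
  obtain ⟨F, -, -, hF⟩ := h
  rw [← hF] at hB
  obtain ⟨a, -, ha⟩ := Finset.exists_ne_zero_of_sum_ne_zero hB
  by_cases h : Ω.IsSink a
  · exact ⟨a, h, by simpa [h] using ha⟩
  · simp [h] at ha

/-- Double counting: in the sum of `d` over the neighbors of all sinks, the value at each source
occurs three times. -/
theorem HasSums.reflect (h3 : G.IsRegularOfDegree 3) (hV : ∀ a, ∃ b, G.Adj a b) {d : V → ℤ}
    {A B : ℤ} (h : Ω.op.HasSums d A B) :
    Ω.HasSums (reflectionAt G {y | Ω.IsSink y} d) B (3 * B - A) := by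
  classical
  obtain ⟨F, hF, hA, hB⟩ := h
  change (∑ a ∈ F, if Ω.IsSink a then d a else 0) = A at hA
  change (∑ a ∈ F, if Ω.IsSource a then d a else 0) = B at hB
  set F' := F ∪ F.biUnion fun a => G.neighborFinset a with hF'
  have hsub : F ⊆ F' := Finset.subset_union_left
  have hd : ∀ a, a ∉ F' → d a = 0 := fun a ha => hF a fun h => ha (hsub h)
  have hnb : ∀ a b, G.Adj a b → d a ≠ 0 → b ∈ F' := fun a b hab ha =>
    Finset.mem_union_right _ (Finset.mem_biUnion.2
      ⟨a, by_contra fun h => ha (hF a h), (G.mem_neighborFinset a b).2 hab⟩)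
  have hA' : (∑ a ∈ F', if Ω.IsSink a then d a else 0) = A := by
    rw [← hA]
    exact (Finset.sum_subset hsub fun a _ ha => by simp [hF a ha]).symm
  have hB' : (∑ a ∈ F', if Ω.IsSource a then d a else 0) = B := by
    rw [← hB]
    exact (Finset.sum_subset hsub fun a _ ha => by simp [hF a ha]).symm
  have hdc : (∑ y ∈ F', if Ω.IsSink y then ∑ z ∈ G.neighborFinset y, d z else 0) = 3 * B := by
    have h1 : ∀ y ∈ F', (if Ω.IsSink y then ∑ z ∈ G.neighborFinset y, d z else 0) =
        ∑ z ∈ F', if Ω.IsSource z ∧ G.Adj z y then d z else 0 := by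
      intro y _
      by_cases hy : Ω.IsSink y
      · rw [if_pos hy, ← Finset.sum_filter]
        refine (Finset.sum_subset (fun z hz => ?_) fun z hz hz' => ?_).symm
        · rw [Finset.mem_filter] at hz
          exact (G.mem_neighborFinset y z).2 hz.2.2.symm
        · have hadj := (G.mem_neighborFinset y z).1 hz
          refine hd z fun h => hz' (Finset.mem_filter.2 ⟨h, ?_, hadj.symm⟩)
          exact (not_isSink_iff hV z).1 (hy.not_isSink_of_adj hadj)
      · rw [if_neg hy]
        refine (Finset.sum_eq_zero fun z _ => if_neg ?_).symm
        rintro ⟨hz, hadj⟩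
        exact hy (IsSink.of_arrow (hz.arrow hadj))
    rw [Finset.sum_congr rfl h1, Finset.sum_comm, ← hB', Finset.mul_sum]
    refine Finset.sum_congr rfl fun z _ => ?_
    by_cases hz : Ω.IsSource z
    · simp only [hz, true_and, if_true]
      by_cases h0 : d z = 0
      · simp [h0]
      · rw [← Finset.sum_filter, Finset.sum_const]
        have : F'.filter (fun y => G.Adj z y) = G.neighborFinset z := by
          ext y
          rw [Finset.mem_filter, G.mem_neighborFinset]
          exact ⟨fun h => h.2, fun h => ⟨hnb z y h h0, h⟩⟩
        rw [this, G.card_neighborFinset_eq_degree, h3 z]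
        simp
    · simp [hz]
  refine ⟨F', fun a ha => ?_, ?_, ?_⟩
  · simp only [reflectionAt, Set.mem_ofPred_eq]
    split_ifs with has
    · rw [hd a ha, neg_zero, zero_add]
      refine Finset.sum_eq_zero fun z hz => by_contra fun hz0 => ?_
      exact ha (hnb z a ((G.mem_neighborFinset a z).1 hz).symm hz0)
    · exact hd a ha
  · rw [← hB']
    refine Finset.sum_congr rfl fun a _ => ?_
    by_cases ha : Ω.IsSource a
    · simp [reflectionAt, ha, (not_isSink_iff hV a).2 ha]
    · simp [ha]
  · rw [← hA', ← hdc, ← Finset.sum_sub_distrib]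
    refine Finset.sum_congr rfl fun a _ => ?_
    by_cases ha : Ω.IsSink a
    · simp only [reflectionAt, Set.mem_ofPred_eq, ha, if_true]
      ring
    · simp [ha]

theorem hasSums_sVec (h3 : G.IsRegularOfDegree 3) (hV : ∀ a, ∃ b, G.Adj a b) (hG : G.Connected)
    (t : ℕ) : ∀ (Ω : BipartiteOrientation G) (x : V), Ω.IsOmega t x →
      Ω.HasSums (sVec G t x) (Nat.fib (2 * t)) (Nat.fib (2 * t + 2)) := by
  induction t with
  | zero =>
    intro Ω x hx
    have hs : Ω.IsSink x := hx.1 Even.zero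
    have hs' : ¬ Ω.IsSource x := fun h => not_isSink_and_isSource hV x ⟨hs, h⟩
    refine ⟨{x}, fun a ha => ?_, ?_, ?_⟩
    · simp [sVec, iterReflect, basisVec, Finset.notMem_singleton.1 ha]
    · simp [hs']
    · simp [sVec, iterReflect, basisVec, hs]
  | succ t ih =>
    intro Ω x hx
    have := (ih Ω.op x ((isOmega_op_iff t x).2 hx)).reflect h3 hV
    rw [sVec, iterReflect_succ hV hG hx]
    convert! this using 1
    have h1 : Nat.fib (2 * t + 2) = Nat.fib (2 * t) + Nat.fib (2 * t + 1) := Nat.fib_add_two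
    have h2 : Nat.fib (2 * t + 3) = Nat.fib (2 * t + 1) + Nat.fib (2 * t + 2) := Nat.fib_add_two
    have h4 : Nat.fib (2 * t + 4) = Nat.fib (2 * t + 2) + Nat.fib (2 * t + 3) := Nat.fib_add_two
    change (Nat.fib (2 * t + 4) : ℤ) = _
    push_cast [h4, h2, h1]
    ring

/-- The sum of `r_t(x, y)` over the sources is `f_{2t-1}`, which is written as a difference to
include the case `t = 0`. -/
theorem hasSums_rVec (h3 : G.IsRegularOfDegree 3) (hV : ∀ a, ∃ b, G.Adj a b) (hG : G.Connected)
    {x y : V} (hxy : G.Adj x y) (t : ℕ) : ∀ Ω : BipartiteOrientation G, Ω.IsOmega t x →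
      Ω.HasSums (rVec G t x y) (Nat.fib (2 * t + 1) - Nat.fib (2 * t)) (Nat.fib (2 * t + 1)) := by
  classical
  induction t with
  | zero =>
    intro Ω hx
    have hs : Ω.IsSink x := hx.1 Even.zero
    have hy : ¬ Ω.IsSink y := hs.not_isSink_of_adj hxy
    have hy' := (not_isSink_iff hV y).1 hy
    have hs' : ¬ Ω.IsSource x := fun h => not_isSink_and_isSource hV x ⟨hs, h⟩
    refine ⟨{x, y}, fun a ha => ?_, ?_, ?_⟩
    · rw [Finset.mem_insert, Finset.mem_singleton, not_or] at ha
      simp [rVec, iterReflect, basisVec, ha.1, ha.2]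
    · rw [Finset.sum_pair hxy.ne]
      simp [rVec, iterReflect, basisVec, hy', hs', hxy.ne']
    · rw [Finset.sum_pair hxy.ne]
      simp [rVec, iterReflect, basisVec, hy, hs, hxy.ne]
  | succ t ih =>
    intro Ω hx
    have := (ih Ω.op ((isOmega_op_iff t x).2 hx)).reflect h3 hV
    rw [rVec, iterReflect_succ hV hG hx]
    have h1 : Nat.fib (2 * t + 2) = Nat.fib (2 * t) + Nat.fib (2 * t + 1) := Nat.fib_add_two
    have h2 : Nat.fib (2 * t + 3) = Nat.fib (2 * t + 1) + Nat.fib (2 * t + 2) := Nat.fib_add_two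
    convert! this using 1
    · change (Nat.fib (2 * t + 3) : ℤ) - Nat.fib (2 * t + 2) = _
      push_cast [h2]
      ring
    · change (Nat.fib (2 * t + 3) : ℤ) = _
      push_cast [h2, h1]
      ring

omit [G.LocallyFinite] in
theorem Rep.HasDimVec.dims {k : Type u} [Field k] {M : Ω.Rep k} {d : V → ℤ} {A B : ℕ}
    (hM : Rep.HasDimVec M d) (hd : Ω.HasSums d A B) :
    Rep.sourceDim M = A ∧ Rep.sinkDim M = B := by
  classical
  obtain ⟨F, hF, hA, hB⟩ := hd
  have key : ∀ p : V → Prop, (∑ᶠ (a : V) (_ : p a), Module.finrank k (Rep.space M a)) =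
      ∑ a ∈ F, if p a then Module.finrank k (Rep.space M a) else 0 := by
    intro p
    simp_rw [finsum_eq_if]
    refine finsum_eq_sum_of_support_subset _ fun a ha => by_contra fun haF => ha ?_
    have h0 : Module.finrank k (Rep.space M a) = 0 := by
      have := (hM a).2
      rw [hF a haF] at this
      exact_mod_cast this
    simp [h0]
  have hcast : ∀ p : V → Prop,
      ((∑ a ∈ F, if p a then Module.finrank k (Rep.space M a) else 0 : ℕ) : ℤ) =
        ∑ a ∈ F, if p a then d a else 0 := by
    intro p
    push_cast
    exact Finset.sum_congr rfl fun a _ => by rw [(hM a).2]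
  rw [Rep.sourceDim, Rep.sinkDim, key, key]
  constructor
  · have := hcast Ω.IsSource
    exact_mod_cast this.trans hA
  · have := hcast Ω.IsSink
    exact_mod_cast this.trans hB

end Sums

/-! ### The Fibonacci modules -/

section Modules

variable {V : Type v} {G : SimpleGraph V} {Ω : BipartiteOrientation G} {k : Type u} [Field k]

/-- If the space at `c` is a line, and every endomorphism is determined by its component at `c`,
then a representation is indecomposable. -/
theorem Rep.indecomposable_of_finrank_eq_one {M : Ω.Rep k} {c : V}
    (hc : Module.finrank k (Rep.space M c) = 1)
    (h : ∀ φ : M ⟶ M, Rep.lin φ c = 0 → φ = 0) : Indecomposable M := by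
  have hnt : Nontrivial (Rep.space M c) := Module.nontrivial_of_finrank_pos (R := k) (by omega)
  refine (Rep.indecomposable_iff M).2 ⟨fun h0 => ?_, fun φ hφ => ?_⟩
  · exact not_subsingleton _ ((Rep.isZero_iff M).1 h0 c)
  · obtain ⟨v, hv⟩ := exists_ne (0 : Rep.space M c)
    have hspan := (finrank_eq_one_iff_of_nonzero' v hv).1 hc
    obtain ⟨r, hr⟩ := hspan (Rep.lin φ c v)
    have hmul : ∀ w, Rep.lin φ c w = r • w := by
      intro w
      obtain ⟨s, rfl⟩ := hspan w
      rw [map_smul, ← hr, smul_comm]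
    have hrr : r * r = r := by
      have := Rep.lin_lin_of_comp_self hφ c v
      rw [hmul, hmul, smul_smul] at this
      exact smul_left_injective k hv this
    rcases IsIdempotentElem.iff_eq_zero_or_one.1 hrr with h0 | h1
    · exact Or.inl (h φ (LinearMap.ext fun w => by rw [hmul, h0, zero_smul]; rfl))
    · right
      refine sub_eq_zero.1 (h (φ - 𝟙 M) (LinearMap.ext fun w => ?_))
      rw [Rep.lin_sub, LinearMap.sub_apply, hmul, h1, one_smul, Rep.lin_id, LinearMap.id_apply,
        sub_self]
      rfl

theorem Rep.HasDimVec.subsingleton {M : Ω.Rep k} {d : V → ℤ} (hM : Rep.HasDimVec M d) {a : V}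
    (ha : d a = 0) : Subsingleton (Rep.space M a) := by
  have := (hM a).1
  refine (Module.finrank_zero_iff (R := k)).1 ?_
  have := (hM a).2
  rw [ha] at this
  exact_mod_cast this

theorem Rep.HasDimVec.not_subsingleton {M : Ω.Rep k} {d : V → ℤ} (hM : Rep.HasDimVec M d) {a : V}
    (ha : d a ≠ 0) : ¬ Subsingleton (Rep.space M a) := by
  intro h
  refine ha ?_
  rw [← (hM a).2, Module.finrank_zero_of_subsingleton, Nat.cast_zero]

theorem Rep.HasDimVec.finrank_eq_one {M : Ω.Rep k} {d : V → ℤ} (hM : Rep.HasDimVec M d) {a : V}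
    (ha : d a = 1) : Module.finrank k (Rep.space M a) = 1 := by
  have := (hM a).2
  rw [ha] at this
  exact_mod_cast this

/-- The representation with spaces of column vectors of given sizes, in which all arrows add up the
coordinates; for sizes at most `1`, these maps are as bijective as they can be. -/
theorem Rep.exists_sum_arr (Ω : BipartiteOrientation G) (k : Type u) [Field k] (n : V → ℕ) :
    ∃ M : Ω.Rep k, Rep.HasDimVec M (fun a => n a) ∧ ∀ a b, Ω.arrow a b → n a = 1 → n b = 1 →
      Function.Surjective (Rep.arr M a b) := by
  obtain ⟨M, E, hE⟩ := Rep.exists_arr_eq (Ω := Ω) (fun a => Fin (n a) → k)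
    (fun a b => LinearMap.pi fun _ => ∑ i, LinearMap.proj (R := k) (φ := fun _ : Fin (n a) => k) i)
  refine ⟨M, fun a => ⟨Module.Finite.equiv (E a), ?_⟩, fun a b hab ha hb w => ?_⟩
  · rw [← (E a).finrank_eq, Module.finrank_fin_fun]
  · obtain ⟨w, rfl⟩ := (E b).surjective w
    refine ⟨E a fun _ => w ⟨0, by omega⟩, ?_⟩
    rw [hE a b hab]
    refine congrArg _ (funext fun j => ?_)
    rw [show j = ⟨0, by omega⟩ from Fin.ext (by omega)]
    simp [ha]

variable [G.LocallyFinite]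

theorem exists_isP_zero (k : Type u) [Field k] {x : V} (hx : Ω.IsOmega 0 x) :
    ∃ M : Ω.Rep k, Rep.IsP 0 x M := by
  classical
  obtain ⟨M, hM, -⟩ := Rep.exists_sum_arr Ω k fun a => if a = x then 1 else 0
  refine ⟨M, hx, ?_, ?_⟩
  · refine Rep.indecomposable_of_finrank_eq_one (c := x) (hM.finrank_eq_one (by simp))
      fun φ hφ => Rep.hom_ext_lin fun a => ?_
    by_cases ha : a = x
    · rw [ha, hφ, Rep.lin_zero]
    · have := hM.subsingleton (a := a) (by simp [ha])
      exact Subsingleton.elim _ _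
  · convert! hM using 2 with a
    simp [sVec, iterReflect, basisVec]

theorem rVec_zero_apply {x y : V} (hxy : G.Adj x y) (a : V) [Decidable (a = x ∨ a = y)] :
    rVec G 0 x y a = if a = x ∨ a = y then 1 else 0 := by
  classical
  by_cases hx : a = x
  · subst hx
    simp [rVec, iterReflect, basisVec, hxy.ne]
  · simp [rVec, iterReflect, basisVec, hx]

theorem exists_isR_zero (k : Type u) [Field k] {x y : V} (hxy : G.Adj x y) (hx : Ω.IsOmega 0 x) :
    ∃ M : Ω.Rep k, Rep.IsR 0 x y M := by
  classical
  obtain ⟨M, hM, hM'⟩ := Rep.exists_sum_arr Ω k fun a => if a = x ∨ a = y then 1 else 0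
  refine ⟨M, hxy, hx, ?_, ?_⟩
  · refine Rep.indecomposable_of_finrank_eq_one (c := y) (hM.finrank_eq_one (by simp))
      fun φ hφ => Rep.hom_ext_lin fun a => ?_
    by_cases hy : a = y
    · rw [hy, hφ, Rep.lin_zero]
    by_cases hxa : a = x
    · subst hxa
      refine LinearMap.ext fun w => ?_
      obtain ⟨v, rfl⟩ := hM' y a ((hx.1 Even.zero).arrow hxy) (by simp) (by simp) w
      rw [Rep.lin_arr, hφ]
      simp
    · have := hM.subsingleton (a := a) (by simp [hxa, hy])
      exact Subsingleton.elim _ _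
  · convert! hM using 2 with a
    rw [rVec_zero_apply hxy]
    simp

/-- The reflection at the sources of an indecomposable representation which does not live at a
source. -/
theorem exists_reflection (hV : ∀ a, ∃ b, G.Adj a b) (hG : G.Connected) {t : ℕ} {x : V}
    (hx : Ω.IsOmega (t + 1) x) {d : V → ℤ} {N : Ω.op.Rep k} (hN : Indecomposable N)
    (hd : Rep.HasDimVec N (iterReflect G x d t))
    (hne : ∃ b, Ω.op.IsSink b ∧ iterReflect G x d t b ≠ 0) :
    ∃ (M : Ω.Rep k) (e : ∀ a, Rep.space N a →ₗ[k] Rep.space M a), IsReflection N M e ∧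
      Indecomposable M ∧ Rep.HasDimVec M (iterReflect G x d (t + 1)) := by
  obtain ⟨b, hb, hb0⟩ := hne
  have : ∀ a, Module.Finite k (Rep.space N a) := fun a => (hd a).1
  obtain ⟨M, e, h⟩ := exists_isReflection N fun y hy => Rep.outMap_injective (a := b) hN hy
    (fun hby => (not_isSink_iff hV b).2 hb (hby ▸ hy)) (hd.not_subsingleton hb0)
  refine ⟨M, e, h, h.indecomposable_iff.1 hN, ?_⟩
  rw [iterReflect_succ hV hG hx]
  exact h.hasDimVec hd

/-- The reflection at the sinks of an indecomposable representation which does not live at a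
sink. -/
theorem exists_reflection_symm (hV : ∀ a, ∃ b, G.Adj a b) (hG : G.Connected) {t : ℕ} {x : V}
    (hx : Ω.IsOmega (t + 1) x) {d : V → ℤ} {M : Ω.Rep k} (hM : Indecomposable M)
    (hd : Rep.HasDimVec M (iterReflect G x d (t + 1)))
    (hne : ∃ b, Ω.op.IsSink b ∧ iterReflect G x d t b ≠ 0) :
    ∃ (N : Ω.op.Rep k) (e : ∀ a, Rep.space N a →ₗ[k] Rep.space M a), IsReflection N M e ∧
      Indecomposable N ∧ Rep.HasDimVec N (iterReflect G x d t) := by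
  obtain ⟨b, hb, hb0⟩ := hne
  have : ∀ a, Module.Finite k (Rep.space M a) := fun a => (hd a).1
  have hbs : ¬ Ω.IsSink b := (not_isSink_iff hV b).2 hb
  have hb1 : iterReflect G x d (t + 1) b ≠ 0 := by
    rw [iterReflect_succ hV hG hx]
    simpa [reflectionAt, hbs] using hb0
  obtain ⟨N, e, h⟩ := exists_isReflection_symm M fun y hy => Rep.inMap_surjective (a := b) hM hy
    (fun hby => hbs (hby ▸ hy)) (hd.not_subsingleton hb1)
  refine ⟨N, e, h, h.indecomposable_iff.2 hM, h.hasDimVec_symm ?_⟩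
  rw [← iterReflect_succ hV hG hx]
  exact hd

section Regular

variable (h3 : G.IsRegularOfDegree 3) (hG : G.Connected)

include h3

theorem exists_adj (a : V) : ∃ b, G.Adj a b := by
  have : 0 < G.degree a := by rw [h3 a]; norm_num
  exact (G.degree_pos_iff_exists_adj a).1 this

include hG

theorem exists_sVec_ne_zero {t : ℕ} {x : V} (hx : Ω.IsOmega t x) :
    ∃ b, Ω.IsSink b ∧ sVec G t x b ≠ 0 :=
  (hasSums_sVec h3 (exists_adj h3) hG t Ω x hx).exists_ne_zero
    (by exact_mod_cast (Nat.fib_pos.2 (by omega)).ne')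

theorem exists_rVec_ne_zero {t : ℕ} {x y : V} (hxy : G.Adj x y) (hx : Ω.IsOmega t x) :
    ∃ b, Ω.IsSink b ∧ rVec G t x y b ≠ 0 :=
  (hasSums_rVec h3 (exists_adj h3) hG hxy t Ω hx).exists_ne_zero
    (by exact_mod_cast (Nat.fib_pos.2 (by omega)).ne')

theorem exists_isP (k : Type u) [Field k] (t : ℕ) : ∀ (Ω : BipartiteOrientation G) (x : V),
    Ω.IsOmega t x → ∃ M : Ω.Rep k, Rep.IsP t x M := by
  induction t with
  | zero => exact fun Ω x hx => exists_isP_zero k hx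
  | succ t ih =>
    intro Ω x hx
    have hx' := (isOmega_op_iff t x).2 hx
    obtain ⟨N, -, hN, hd⟩ := ih Ω.op x hx'
    obtain ⟨M, e, -, hM, hd'⟩ := exists_reflection (exists_adj h3) hG hx hN hd
      (exists_sVec_ne_zero h3 hG hx')
    exact ⟨M, hx, hM, hd'⟩

theorem exists_isR (k : Type u) [Field k] {x y : V} (hxy : G.Adj x y) (t : ℕ) :
    ∀ Ω : BipartiteOrientation G, Ω.IsOmega t x → ∃ M : Ω.Rep k, Rep.IsR t x y M := by
  induction t with
  | zero => exact fun Ω hx => exists_isR_zero k hxy hx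
  | succ t ih =>
    intro Ω hx
    have hx' := (isOmega_op_iff t x).2 hx
    obtain ⟨N, -, -, hN, hd⟩ := ih Ω.op hx'
    obtain ⟨M, e, -, hM, hd'⟩ := exists_reflection (exists_adj h3) hG hx hN hd
      (exists_rVec_ne_zero h3 hG hxy hx')
    exact ⟨M, hxy, hx, hM, hd'⟩

theorem Rep.IsP.exists_isReflection {t : ℕ} {x : V} {M : Ω.Rep k} (hM : Rep.IsP (t + 1) x M) :
    ∃ (N : Ω.op.Rep k) (e : ∀ a, Rep.space N a →ₗ[k] Rep.space M a),
      IsReflection N M e ∧ Rep.IsP t x N := by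
  have hx := (isOmega_op_iff t x).2 hM.1
  obtain ⟨N, e, h, hN, hd⟩ := exists_reflection_symm (exists_adj h3) hG hM.1 hM.2.1 hM.2.2
    (exists_sVec_ne_zero h3 hG hx)
  exact ⟨N, e, h, hx, hN, hd⟩

theorem Rep.IsR.exists_isReflection {t : ℕ} {x y : V} {M : Ω.Rep k}
    (hM : Rep.IsR (t + 1) x y M) :
    ∃ (N : Ω.op.Rep k) (e : ∀ a, Rep.space N a →ₗ[k] Rep.space M a),
      IsReflection N M e ∧ Rep.IsR t x y N := by
  have hx := (isOmega_op_iff t x).2 hM.2.1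
  obtain ⟨N, e, h, hN, hd⟩ := exists_reflection_symm (exists_adj h3) hG hM.2.1 hM.2.2.1 hM.2.2.2
    (exists_rVec_ne_zero h3 hG hM.1 hx)
  exact ⟨N, e, h, hM.1, hx, hN, hd⟩

end Regular

end Modules

/-! ### The exact sequences -/

section Sequences

variable {V : Type v} {G : SimpleGraph V} [G.LocallyFinite] {Ω : BipartiteOrientation G}
  {k : Type u} [Field k]

/-- If all neighbors of the sink `b` but `c` carry the zero space, then the whole image in the space
at `b` comes from `c`. -/
theorem Rep.arr_surjective {M : Ω.Rep k} {b c : V} (hbc : G.Adj b c)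
    (h : Function.Surjective (Rep.inMap M b))
    (h0 : ∀ a, G.Adj b a → a ≠ c → Subsingleton (Rep.space M a)) :
    Function.Surjective (Rep.arr M c b) := by
  intro m
  obtain ⟨v, rfl⟩ := h m
  refine ⟨v ⟨c, hbc⟩, ?_⟩
  rw [Rep.inMap_apply, Finset.sum_eq_single (⟨c, hbc⟩ : G.neighborSet b)]
  · intro a _ ha
    have := h0 a a.2 fun h => ha (Subtype.ext h)
    rw [Subsingleton.elim (v a) 0, map_zero]
  · simp

theorem Rep.IsR.finrank_zero {b c : V} {M : Ω.Rep k} (hM : Rep.IsR 0 b c M) (a : V)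
    [Decidable (a = b ∨ a = c)] :
    Module.finrank k (Rep.space M a) = if a = b ∨ a = c then 1 else 0 := by
  have := (hM.2.2.2 a).2
  rw [rVec_zero_apply hM.1 a] at this
  exact_mod_cast this

theorem Rep.IsR.subsingleton {b c a : V} {M : Ω.Rep k} (hM : Rep.IsR 0 b c M) (hb : a ≠ b)
    (hc : a ≠ c) : Subsingleton (Rep.space M a) := by
  classical
  exact hM.2.2.2.subsingleton (by rw [rVec_zero_apply hM.1]; simp [hb, hc])

theorem Rep.IsR.arr_surjective {b c : V} {M : Ω.Rep k} (hM : Rep.IsR 0 b c M) :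
    Function.Surjective (Rep.arr M c b) := by
  classical
  have hb : Ω.IsSink b := hM.2.1.1 Even.zero
  refine Rep.arr_surjective hM.1 (Rep.inMap_surjective hM.2.2.1 hb hM.1.ne'
    (hM.2.2.2.not_subsingleton ?_)) fun a ha hac => hM.subsingleton ha.ne' hac
  rw [rVec_zero_apply hM.1]
  simp

theorem bijective_of_surjective_of_finrank_eq {A B : Type*} [AddCommGroup A] [AddCommGroup B]
    [Module k A] [Module k B] {n : ℕ} (hA : Module.finrank k A = n + 1)
    (hB : Module.finrank k B = n + 1) {f : A →ₗ[k] B} (hf : Function.Surjective f) :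
    Function.Bijective f := by
  have := Module.finite_of_finrank_pos (R := k) (M := A) (by omega)
  have := Module.finite_of_finrank_pos (R := k) (M := B) (by omega)
  exact ⟨(LinearMap.injective_iff_surjective_of_finrank_eq_finrank (hA.trans hB.symm)).2 hf, hf⟩

/-- A representation which looks like `R_0(b, c)` at `b` and at all the sources has `R_0(b, c)` as
a factor. -/
theorem Rep.IsR.exists_hom {b c : V} {M N : Ω.Rep k} (hM : Rep.IsR 0 b c M)
    (h0 : ∀ a, ¬ Ω.IsSink a → a ≠ c → Subsingleton (Rep.space N a))
    (hb : Module.finrank k (Rep.space N b) = 1) (hc : Module.finrank k (Rep.space N c) = 1)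
    (hs : Function.Surjective (Rep.arr N c b)) :
    ∃ g : N ⟶ M, Function.Bijective (Rep.lin g b) ∧ Function.Bijective (Rep.lin g c) := by
  classical
  have hMb : Module.finrank k (Rep.space M b) = 1 := by rw [hM.finrank_zero]; simp
  have hMc : Module.finrank k (Rep.space M c) = 1 := by rw [hM.finrank_zero]; simp
  have := Module.finite_of_finrank_pos (R := k) (M := Rep.space M c) (by omega)
  have := Module.finite_of_finrank_pos (R := k) (M := Rep.space N c) (by omega)
  let E : Rep.space N c ≃ₗ[k] Rep.space M c := LinearEquiv.ofFinrankEq _ _ (hc.trans hMc.symm)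
  obtain ⟨r, hr⟩ := exists_factor_of_surjective (Rep.arr N c b)
    (Rep.arr M c b ∘ₗ E.toLinearMap) hs fun v hv => by
      rw [(bijective_of_surjective_of_finrank_eq hc hb hs).1 (hv.trans (map_zero _).symm), map_zero]
  let φ : ∀ a, Rep.space N a →ₗ[k] Rep.space M a :=
    Function.update (Function.update (fun _ => 0) c E.toLinearMap) b r
  have hφb : φ b = r := Function.update_self _ _ _
  have hφc : φ c = E.toLinearMap := by
    simp only [φ]
    rw [Function.update_of_ne hM.1.ne', Function.update_self]
  obtain ⟨g, hg⟩ := Rep.exists_lin_eq φ (by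
    intro a d had v
    have hd := IsSink.of_arrow had
    by_cases hac : a = c
    · subst hac
      by_cases hdb : d = b
      · subst hdb
        rw [hφb, hφc, hr]
        rfl
      · have := hM.subsingleton hdb (adj_of_arrow had).ne'
        exact Subsingleton.elim _ _
    · have := h0 a (hd.not_isSink_of_adj (adj_of_arrow had).symm) hac
      rw [Subsingleton.elim v 0]
      simp)
  refine ⟨g, ?_, ?_⟩
  · rw [hg, hφb]
    refine bijective_of_surjective_of_finrank_eq hb hMb fun m => ?_
    obtain ⟨v, rfl⟩ := hM.arr_surjective m
    exact ⟨Rep.arr N c b (E.symm v), by rw [hr]; simp⟩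
  · rw [hg, hφc]
    exact E.bijective

/-- A linear map out of the space at a sink is a morphism, if the representation lives at this
sink. -/
theorem Rep.IsP.exists_hom {y : V} {M N : Ω.Rep k} (hM : Rep.IsP 0 y M)
    (l : Rep.space M y →ₗ[k] Rep.space N y) : ∃ φ : M ⟶ N, Rep.lin φ y = l := by
  classical
  let φ : ∀ a, Rep.space M a →ₗ[k] Rep.space N a := Function.update (fun _ => 0) y l
  obtain ⟨ψ, hψ⟩ := Rep.exists_lin_eq φ (by
    intro a b hab v
    have hay : a ≠ y := fun h => hM.1.1 Even.zero b (h ▸ hab)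
    have := hM.2.2.subsingleton (a := a) (by simp [sVec, iterReflect, basisVec, hay])
    rw [Subsingleton.elim v 0]
    simp)
  exact ⟨ψ, (hψ y).trans (Function.update_self _ _ _)⟩

/-- Given `0 → ⨁ P i → R → Q → 0` and a morphism from `Q` to `S` which is surjective, with a
kernel that lives at the sink `y`, a representation `P'` which lives at `y` can be lifted to `R`,
because it is projective. So it splits off from the kernel of the composition `R → Q → S`. -/
theorem Rep.IsExactSeq.extend {n : ℕ} {P : Fin (n + 1) → Ω.Rep k} {R Q S : Ω.Rep k}
    {f : ∀ i : Fin n, P i.succ ⟶ R} {g : R ⟶ Q} (h : Rep.IsExactSeq f g) {y : V}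
    (hP : Rep.IsP 0 y (P 0)) (hQ : Module.finrank k (Rep.space Q y) = 1) {q : Q ⟶ S}
    (hq : ∀ a, Function.Surjective (Rep.lin q a))
    (hq' : ∀ a, a ≠ y → Function.Injective (Rep.lin q a)) (hqy : Rep.lin q y = 0) :
    ∃ (f : ∀ i, P i ⟶ R) (g : R ⟶ S), Rep.IsExactSeq f g := by
  have hPy : Module.finrank k (Rep.space (P 0) y) = 1 :=
    hP.2.2.finrank_eq_one (by simp [sVec, iterReflect, basisVec])
  have hP0 : ∀ a, a ≠ y → Subsingleton (Rep.space (P 0) a) := fun a ha =>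
    hP.2.2.subsingleton (by simp [sVec, iterReflect, basisVec, ha])
  have := Module.finite_of_finrank_pos (R := k) (M := Rep.space (P 0) y) (by omega)
  have := Module.finite_of_finrank_pos (R := k) (M := Rep.space Q y) (by omega)
  let E : Rep.space (P 0) y ≃ₗ[k] Rep.space Q y := LinearEquiv.ofFinrankEq _ _ (hPy.trans hQ.symm)
  obtain ⟨s, hs⟩ := (Rep.lin g y).exists_rightInverse_of_surjective
    (LinearMap.range_eq_top.2 (h.surj y))
  obtain ⟨f₀, hf₀⟩ := hP.exists_hom (s ∘ₗ E.toLinearMap)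
  have hgf₀ : ∀ p, Rep.lin g y (Rep.lin f₀ y p) = E p := fun p => by
    rw [hf₀]
    exact LinearMap.congr_fun hs (E p)
  have hgf : ∀ a (p : ∀ i : Fin n, Rep.space (P i.succ) a),
      Rep.lin g a (∑ i, Rep.lin (f i) a (p i)) = 0 := fun a p => (h.exact a _).2 ⟨p, rfl⟩
  let F : ∀ i, P i ⟶ R := Fin.cons (α := fun i => P i ⟶ R) f₀ f
  have hF : ∀ a (p : ∀ i, Rep.space (P i) a), ∑ i, Rep.lin (F i) a (p i) =
      Rep.lin f₀ a (p 0) + ∑ i : Fin n, Rep.lin (f i) a (p i.succ) := fun a p =>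
    Fin.sum_univ_succ _
  refine ⟨F, g ≫ q, fun a p hp => ?_, fun a r => ⟨fun hr => ?_, ?_⟩, fun a =>
    (hq a).comp (h.surj a)⟩
  · rw [hF] at hp
    have hp0 : p 0 = 0 := by
      by_cases ha : a = y
      · subst ha
        have := congrArg (Rep.lin g a) hp
        rw [map_add, hgf, add_zero, hgf₀, map_zero] at this
        exact E.map_eq_zero_iff.1 this
      · have := hP0 a ha
        exact Subsingleton.elim _ _
    rw [hp0, map_zero, zero_add] at hp
    have hps := h.inj a _ hp
    funext i
    refine Fin.cases hp0 (fun j => congrFun hps j) i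
  · have key : ∃ p₀, Rep.lin g a (r - Rep.lin f₀ a p₀) = 0 := by
      by_cases ha : a = y
      · subst ha
        exact ⟨E.symm (Rep.lin g a r), by rw [map_sub, hgf₀, LinearEquiv.apply_symm_apply, sub_self]⟩
      · refine ⟨0, ?_⟩
        rw [map_zero, sub_zero]
        exact hq' a ha (hr.trans (map_zero _).symm)
    obtain ⟨p₀, hp₀⟩ := key
    obtain ⟨p, hp⟩ := (h.exact a _).1 hp₀
    refine ⟨Fin.cons (α := fun i => Rep.space (P i) a) p₀ p, ?_⟩
    rw [hF]
    simp only [Fin.cons_zero, Fin.cons_succ]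
    rw [hp, add_sub_cancel]
  · rintro ⟨p, rfl⟩
    rw [hF, Rep.lin_comp, LinearMap.comp_apply, map_add, hgf, add_zero]
    by_cases ha : a = y
    · subst ha
      rw [hqy]
      rfl
    · have := hP0 a ha
      rw [Subsingleton.elim (p 0) 0]
      simp

/-- The neighbors of a vertex of degree three, three of them being known. -/
theorem eq_or_eq_or_eq_of_adj (h3 : G.IsRegularOfDegree 3) {a b c d x : V} (hb : G.Adj a b)
    (hc : G.Adj a c) (hd : G.Adj a d) (hbc : b ≠ c) (hbd : b ≠ d) (hcd : c ≠ d)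
    (hx : G.Adj a x) : x = b ∨ x = c ∨ x = d := by
  classical
  have hsub : ({b, c, d} : Finset V) ⊆ G.neighborFinset a := by
    intro y hy
    rw [Finset.mem_insert, Finset.mem_insert, Finset.mem_singleton] at hy
    rw [G.mem_neighborFinset]
    rcases hy with rfl | rfl | rfl <;> assumption
  have heq := Finset.eq_of_subset_of_card_le hsub (by
    rw [G.card_neighborFinset_eq_degree, h3 a, Finset.card_eq_three.2 ⟨b, c, d, hbc, hbd, hcd, rfl⟩])
  have hx' := (G.mem_neighborFinset a x).2 hx
  rw [← heq] at hx'
  simpa using hx'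

/-- A reflection `Q` of `R_0(c, d)`, that is, `R_1(c, d)`, has the factor `R_0(b, c)`, where `b` and
`y` are the other neighbors of `c`; the kernel lives at `y`. -/
theorem exists_hom_of_reflection (h3 : G.IsRegularOfDegree 3) {b c d y : V} {N : Ω.op.Rep k}
    {Q S : Ω.Rep k} {e : ∀ a, Rep.space N a →ₗ[k] Rep.space Q a} (h : IsReflection N Q e)
    (hN : Rep.IsR 0 c d N) (hS : Rep.IsR 0 b c S) (hdb : d ≠ b) (hcy : G.Adj c y) (hyb : y ≠ b)
    (hyd : y ≠ d) :
    Module.finrank k (Rep.space Q y) = 1 ∧ ∃ q : Q ⟶ S,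
      (∀ a, Function.Surjective (Rep.lin q a)) ∧
      (∀ a, a ≠ y → Function.Injective (Rep.lin q a)) ∧ Rep.lin q y = 0 := by
  classical
  have hb : Ω.IsSink b := hS.2.1.1 Even.zero
  have hc : Ω.IsSource c := hN.2.1.1 Even.zero
  have hcd : G.Adj c d := hN.1
  have hbc : G.Adj b c := hS.1
  have hd : Ω.IsSink d := IsSink.of_arrow (hc.arrow hcd)
  have hy : Ω.IsSink y := IsSink.of_arrow (hc.arrow hcy)
  have hcs : ¬ Ω.IsSink c := hb.not_isSink_of_adj hbc
  have : ∀ a, Module.Finite k (Rep.space N a) := fun a => (hN.2.2.2 a).1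
  have : ∀ a, Module.Finite k (Rep.space Q a) := h.finite
  have hQc : Module.finrank k (Rep.space Q c) = 1 := by
    rw [← h.finrank_eq hcs, hN.finrank_zero]
    simp
  have hQ0 : ∀ a, ¬ Ω.IsSink a → a ≠ c → Subsingleton (Rep.space Q a) := by
    intro a ha hac
    have hda : a ≠ d := fun h => ha (h ▸ hd)
    refine (Module.finrank_zero_iff (R := k)).1 ?_
    rw [← h.finrank_eq ha, hN.finrank_zero]
    simp [hac, hda]
  -- the dimension at the sink `a` is `1` for `b` and `y`, and `0` otherwise
  have hQs : ∀ a, Ω.IsSink a → (if a = d then 1 else 0) + Module.finrank k (Rep.space Q a) =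
      if G.Adj a c then 1 else 0 := by
    intro a ha
    have h1 := h.finrank_add_finrank ha
    have hac : a ≠ c := fun h => hcs (h ▸ ha)
    rw [hN.finrank_zero] at h1
    simp only [hac, false_or] at h1
    rw [h1]
    have h2 : ∀ z ∈ G.neighborFinset a, Module.finrank k (Rep.space N z) =
        if z = c then 1 else 0 := by
      intro z hz
      have hzd : z ≠ d := fun h =>
        ha.not_isSink_of_adj ((G.mem_neighborFinset a z).1 hz) (h ▸ hd)
      rw [hN.finrank_zero]
      simp [hzd]
    rw [Finset.sum_congr rfl h2, Finset.sum_ite_eq']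
    simp
  have hQb : Module.finrank k (Rep.space Q b) = 1 := by
    have := hQs b hb
    simpa [hdb.symm, hbc] using this
  have hQy : Module.finrank k (Rep.space Q y) = 1 := by
    have := hQs y hy
    simpa [hyd, hcy.symm] using this
  have hQa : ∀ a, a ≠ y → a ≠ b → a ≠ c → Subsingleton (Rep.space Q a) := by
    intro a hay hab hac
    by_cases ha : Ω.IsSink a
    · refine (Module.finrank_zero_iff (R := k)).1 ?_
      have h1 := hQs a ha
      by_cases hadj : G.Adj a c
      · have had : a = d := ((eq_or_eq_or_eq_of_adj h3 hbc.symm hcd hcy hdb.symm hyb.symm hyd.symm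
          hadj.symm).resolve_left hab).resolve_right hay
        rw [if_pos had, if_pos hadj] at h1
        omega
      · rw [if_neg hadj] at h1
        omega
    · exact hQ0 a ha hac
  have hQarr : Function.Surjective (Rep.arr Q c b) := Rep.arr_surjective hbc (h.surj b hb)
    fun a ha hac => hQ0 a (hb.not_isSink_of_adj ha) hac
  obtain ⟨q, hqb, hqc⟩ := hS.exists_hom hQ0 hQb hQc hQarr
  refine ⟨hQy, q, fun a => ?_, fun a hay => ?_, ?_⟩
  · by_cases hab : a = b
    · exact hab ▸ hqb.2
    by_cases hac : a = c
    · exact hac ▸ hqc.2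
    have := hS.subsingleton hab hac
    exact fun m => ⟨0, Subsingleton.elim _ _⟩
  · by_cases hab : a = b
    · exact hab ▸ hqb.1
    by_cases hac : a = c
    · exact hac ▸ hqc.1
    have := hQa a hay hab hac
    exact Function.injective_of_subsingleton _
  · have := hS.subsingleton hyb hcy.ne'
    exact LinearMap.ext fun v => Subsingleton.elim _ _

/-- The exact sequence for a path `w 0, …, w (n + 1)`. For `n = 0` it is an isomorphism between two
copies of `R_0(w 0, w 1)`. In general, the sequence for the path `w 1, …, w (n + 1)` and the
opposite orientation is reflected, which gives a sequence that ends in `R_1(w 1, w 2)`, and then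
this module is mapped to `R_0(w 0, w 1)`. -/
theorem exists_isExactSeq (h3 : G.IsRegularOfDegree 3) (hG : G.Connected) (n : ℕ) :
    ∀ (Ω : BipartiteOrientation G) (w : ℕ → V) (z : Fin n → V),
      (∀ i, i ≤ n → G.Adj (w i) (w (i + 1))) → (∀ i, i < n → w (i + 2) ≠ w i) →
      (∀ i : Fin n, G.Adj (w (i + 1)) (z i) ∧ z i ≠ w i ∧ z i ≠ w (i + 2)) →
      ∀ (P : Fin n → Ω.Rep k) (R S : Ω.Rep k), (∀ i : Fin n, Rep.IsP i (z i) (P i)) →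
      Rep.IsR n (w n) (w (n + 1)) R → Rep.IsR 0 (w 0) (w 1) S →
      ∃ (f : ∀ i, P i ⟶ R) (g : R ⟶ S), Rep.IsExactSeq f g := by
  classical
  induction n with
  | zero =>
    intro Ω w z _ _ _ P R S _ hR hS
    obtain ⟨g, hb, hc⟩ := hS.exists_hom (N := R)
      (fun a ha hac => hR.subsingleton (fun h => ha (h ▸ hR.2.1.1 Even.zero)) hac)
      (by rw [hR.finrank_zero]; simp) (by rw [hR.finrank_zero]; simp) hR.arr_surjective
    have hbij : ∀ a, Function.Bijective (Rep.lin g a) := by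
      intro a
      by_cases hab : a = w 0
      · exact hab ▸ hb
      by_cases hac : a = w 1
      · exact hac ▸ hc
      have := hS.subsingleton hab hac
      have := hR.subsingleton hab hac
      exact ⟨Function.injective_of_subsingleton _, fun m => ⟨0, Subsingleton.elim _ _⟩⟩
    refine ⟨fun i => i.elim0, g, fun a p _ => funext fun i => i.elim0, fun a r => ?_,
      fun a => (hbij a).2⟩
    simp only [Finset.univ_eq_empty, Finset.sum_empty, exists_const]
    exact ⟨fun h => ((hbij a).1 (h.trans (map_zero _).symm)).symm, fun h => h ▸ map_zero _⟩
  | succ n ih =>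
    intro Ω w z hw hw' hz P R S hP hR hS
    have h01 := hw 0 (by omega)
    have h12 := hw 1 (by omega)
    obtain ⟨N', e', h', hN'⟩ := hR.exists_isReflection h3 hG
    choose N e h hN using fun i : Fin n => (hP i.succ).exists_isReflection h3 hG
    have hsource : Ω.op.IsOmega 0 (w 1) :=
      ⟨fun _ => (not_isSink_iff (exists_adj h3) _).1
        ((hS.2.1.1 Even.zero).not_isSink_of_adj h01), fun h => absurd h (by decide)⟩
    have hsource' := (isOmega_op_iff 0 (w 1)).1 hsource
    obtain ⟨N'', hN''⟩ := exists_isR_zero k h12 hsource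
    obtain ⟨Q, e'', h'', -, -⟩ := exists_reflection (exists_adj h3) hG hsource' hN''.2.2.1
      hN''.2.2.2 (exists_rVec_ne_zero h3 hG h12 hsource)
    obtain ⟨f, g, hfg⟩ := ih Ω.op (fun i => w (i + 1)) (fun i => z i.succ)
      (fun i hi => hw (i + 1) (by omega)) (fun i hi => hw' (i + 1) (by omega))
      (fun i => hz i.succ) N N' N'' hN hN' hN''
    choose F hF using fun i => (h i).exists_hom h' (f i)
    obtain ⟨g', hg'⟩ := h'.exists_hom h'' g
    have hFg := hfg.reflect h h' h'' hF hg'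
    have hz0 := hz 0
    obtain ⟨hQ, q, hq, hq', hq0⟩ := exists_hom_of_reflection h3 h'' hN'' hS (hw' 0 (by omega))
      hz0.1 hz0.2.1 hz0.2.2
    exact hFg.extend (hP 0) hQ hq hq' hq0

end Sequences


end BipartiteOrientation

end Fibonacci

end

theorem Fibonacci.fib_eq_one_add_sum (t : ℕ) :
    Nat.fib (2 * t + 1) = 1 + ∑ i ∈ Finset.Icc 1 t, Nat.fib (2 * i) := by
  induction t with
  | zero => simp
  | succ t ih =>
    rw [Finset.sum_Icc_succ_top (by omega), ← add_assoc, ← ih]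
    exact Nat.fib_add_two

theorem corollary4p3 {k : Type*} [Field k] {V : Type*} (G : SimpleGraph V) [G.LocallyFinite]
    (hT : G.IsTree) (h3 : G.IsRegularOfDegree 3)
    (Ω : Fibonacci.BipartiteOrientation G) (t : ℕ)
    -- the path `x_{-1}, x_0, …, x_{t+1}` (the values of `x` at other integers play no role)
    (x : ℤ → V)
    (hadj : ∀ i : ℤ, -1 ≤ i → i ≤ t → G.Adj (x i) (x (i + 1)))
    (hpath : ∀ i : ℤ, 0 ≤ i → i ≤ t → x (i + 1) ≠ x (i - 1))
    (hsource : Ω.IsSource (x 0))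
    -- the third neighbor `z_i` of `x_i`, for `0 ≤ i ≤ t`
    (z : Fin (t + 1) → V)
    (hz : ∀ i : Fin (t + 1), G.Adj (x (i : ℕ)) (z i) ∧
      z i ≠ x ((i : ℕ) - 1) ∧ z i ≠ x ((i : ℕ) + 1)) :
    -- the Fibonacci modules exist, as representations of the same quiver
    ((∃ P : Fin (t + 1) → Ω.Rep k, ∀ i, (P i).IsP i (z i)) ∧
      (∃ R : Ω.Rep k, R.IsR (t + 1) (x t) (x (t + 1))) ∧
      (∃ R₀ : Ω.Rep k, R₀.IsR 0 (x (-1)) (x 0))) ∧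
    -- the exact sequence, and the numbers which it categorifies
    (∀ (P : Fin (t + 1) → Ω.Rep k) (R R₀ : Ω.Rep k), (∀ i, (P i).IsP i (z i)) →
      R.IsR (t + 1) (x t) (x (t + 1)) → R₀.IsR 0 (x (-1)) (x 0) →
      (∃ (f : (⨁ P) ⟶ R) (g : R ⟶ R₀) (w : f ≫ g = 0), (ShortComplex.mk f g w).ShortExact) ∧
      (R.sourceDim = Nat.fib (2 * t + 1) ∧ R₀.sourceDim = 1 ∧
        ∀ i : Fin (t + 1), (P i).sourceDim = Nat.fib (2 * i)) ∧
      (R.sinkDim = Nat.fib (2 * t + 3) ∧ R₀.sinkDim = 1 ∧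
        ∀ i : Fin (t + 1), (P i).sinkDim = Nat.fib (2 * i + 2))) ∧
    Nat.fib (2 * t + 1) = 1 + ∑ i ∈ Finset.Icc 1 t, Nat.fib (2 * i) := by
  open Fibonacci BipartiteOrientation in
  classical
  have hG := hT.connected
  have hV := exists_adj h3
  -- the path, numbered from `0`
  let w : ℕ → V := fun i => x ((i : ℤ) - 1)
  have hwx : ∀ i : ℕ, w (i + 1) = x i := fun i => congrArg x (by push_cast; ring)
  have hwx' : ∀ i : ℕ, w (i + 2) = x ((i : ℤ) + 1) := fun i => congrArg x (by push_cast; ring)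
  have hw0 : w 0 = x (-1) := congrArg x (by norm_num)
  have hw1 : w 1 = x 0 := hwx 0
  have hw : ∀ i, i ≤ t + 1 → G.Adj (w i) (w (i + 1)) := by
    intro i hi
    rw [hwx]
    have := hadj ((i : ℤ) - 1) (by omega) (by omega)
    rwa [sub_add_cancel] at this
  have hw' : ∀ i, i < t + 1 → w (i + 2) ≠ w i := by
    intro i hi
    rw [hwx']
    exact hpath i (by omega) (by omega)
  have hz' : ∀ i : Fin (t + 1), G.Adj (w (i + 1)) (z i) ∧ z i ≠ w i ∧ z i ≠ w (i + 2) := by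
    intro i
    rw [hwx, hwx']
    exact hz i
  -- along the path, sources and sinks alternate
  have halt : ∀ i, i ≤ t + 1 → Ω.IsOmega i (w i) := by
    intro i hi
    induction i with
    | zero =>
      refine ⟨fun _ => ?_, fun h => absurd h (by decide)⟩
      exact IsSink.of_arrow ((hw1 ▸ hsource : Ω.IsSource (w 1)).arrow (hw 0 (by omega)).symm)
    | succ i ih =>
      obtain ⟨h1, h2⟩ := ih (by omega)
      have hadj := hw i (by omega)
      refine ⟨fun h => ?_, fun h => ?_⟩
      · refine IsSink.of_arrow ((h2 ?_).arrow hadj)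
        rwa [Nat.even_add_one, Nat.not_even_iff_odd] at h
      · refine IsSource.of_arrow ((h1 ?_).arrow hadj)
        rwa [Nat.odd_add_one, Nat.not_odd_iff_even] at h
  have hzO : ∀ i : Fin (t + 1), Ω.IsOmega i (z i) := by
    intro i
    obtain ⟨h1, h2⟩ := halt (i + 1) (by omega)
    have hadj := (hz' i).1
    exact ⟨fun h => IsSink.of_arrow ((h2 h.add_one).arrow hadj),
      fun h => IsSource.of_arrow ((h1 h.add_one).arrow hadj)⟩
  have hadjt : G.Adj (x t) (x (t + 1)) := hadj t (by omega) le_rfl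
  have hadj0 : G.Adj (x (-1)) (x 0) := hadj (-1) le_rfl (by omega)
  have hOt : Ω.IsOmega (t + 1) (x t) := hwx t ▸ halt (t + 1) le_rfl
  have hO0 : Ω.IsOmega 0 (x (-1)) := hw0 ▸ halt 0 (by omega)
  refine ⟨⟨?_, exists_isR h3 hG k hadjt (t + 1) Ω hOt, exists_isR h3 hG k hadj0 0 Ω hO0⟩,
    fun P R R₀ hP hR hR₀ => ⟨?_, ?_⟩, fib_eq_one_add_sum t⟩
  · choose P hP using fun i : Fin (t + 1) => exists_isP h3 hG k i Ω (z i) (hzO i)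
    exact ⟨P, hP⟩
  · rw [← hwx, ← hwx'] at hR
    rw [← hw0, ← hw1] at hR₀
    obtain ⟨f, g, hfg⟩ := exists_isExactSeq h3 hG (t + 1) Ω w z hw hw' hz' P R R₀ hP hR hR₀
    exact hfg.exists_shortExact
  · have hfib : Nat.fib (2 * (t + 1) + 1) = Nat.fib (2 * t + 1) + Nat.fib (2 * (t + 1)) :=
      Nat.fib_add_two
    have h1 : Rep.sourceDim R = Nat.fib (2 * t + 1) ∧ Rep.sinkDim R = Nat.fib (2 * (t + 1) + 1) := by
      refine Rep.HasDimVec.dims hR.2.2.2 ?_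
      have := hasSums_rVec h3 hV hG hadjt (t + 1) Ω hOt
      rwa [hfib, Nat.cast_add, add_sub_cancel_right, ← Nat.cast_add, ← hfib] at this
    have h2 : Rep.sourceDim R₀ = 1 ∧ Rep.sinkDim R₀ = 1 :=
      Rep.HasDimVec.dims hR₀.2.2.2 (by simpa using hasSums_rVec h3 hV hG hadj0 0 Ω hO0)
    have hPi : ∀ i, Rep.sourceDim (P i) = Nat.fib (2 * i) ∧ Rep.sinkDim (P i) = Nat.fib (2 * i + 2) :=
      fun i => Rep.HasDimVec.dims (hP i).2.2 (hasSums_sVec h3 hV hG i Ω (z i) (hzO i))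
    exact ⟨⟨h1.1, h2.1, fun i => (hPi i).1⟩, h1.2, h2.2, fun i => (hPi i).2⟩
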